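/- Let $\mathbb K=\mathbb R$ or $\mathbb C$. For an $n\times n$ real symmetric ($\mathbb K=\mathbb R$) or complex Hermitian ($\mathbb K=\mathbb C$) matrix $M$ write $\lambda_1(M)\ge\cdots\ge\lambda_n(M)$ for its eigenvalues counted with multiplicity. For every $n$ let $X_n$ be a random $n\times n$ matrix of this kind, all defined on one probability space. Assume that the empirical eigenvalue distribution $\frac1n\sum_{j=1}^n\delta_{\lambda_j(X_n)}$ converges weakly, almost surely, to a non-random compactly supported probability measure $\mu_X$ on $\mathbb R$. Let $a$ and $b$ be the infimum and the supremum of the support of $\mu_X$, and assume that $\lambda_n(X_n)\to a$ and $\lambda_1(X_n)\to b$ almost surely. Let $r\ge1$, let $0\le s\le r$, and let $\theta_1\ge\cdots\ge\theta_s>0>\theta_{s+1}\ge\cdots\ge\theta_r$ be deterministic real numbers that do not depend on $n$. For every $n\ge r$ let $P_n$ be a random $n\times n$ matrix of the same kind (symmetric or Hermitian), on the same probability space, of rank $r$, whose $r$ non-zero eigenvalues, counted with multiplicity, are $\theta_1,\dots,\theta_r$. Assume that for every $n\ge r$ the matrices $X_n$ and $P_n$ are independent and that the law of at least one of them is invariant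 under conjugation by all orthogonal (if $\mathbb K=\mathbb R$), respectively unitary (if $\mathbb K=\mathbb C$), $n\times n$ matrices. Put $\widetilde X_n=X_n+P_n$. Let $G_{\mu_X}(z)=\int\frac{1}{z-t}\,d\mu_X(t)$ for $z\notin\operatorname{supp}\mu_X$ be the Cauchy transform of $\mu_X$, let $G_{\mu_X}(b^+)=\lim_{z\downarrow b}G_{\mu_X}(z)\in(0,+\infty]$ and $G_{\mu_X}(a^-)=\lim_{z\uparrow a}G_{\mu_X}(z)\in[-\infty,0)$, with the convention $1/(\pm\infty)=0$, and let $G_{\mu_X}^{-1}$ denote the inverses of the decreasing homeomorphisms that $G_{\mu_X}$ induces from $(b,+\infty)$ onto $(0,G_{\mu_X}(b^+))$ and from $(-\infty,a)$ onto $(G_{\mu_X}(a^-),0)$. Then, as $n\to\infty$: (1) for each $1\le i\le s$, almost surely $$\lambda_i(\widetilde X_n)\longrightarrow\begin{cases}G_{\mu_X}^{-1}(1/\theta_i)&\text{if }\theta_i>1/G_{\mu_X}(b^+),\\ b&\text{otherwise;}\end{cases}$$ (2) for each fixed $i>s$, almost surely $\lambda_i(\widetilde X_n)\to b$; (3) for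 each $0\le j<r-s$, almost surely $$\lambda_{n-j}(\widetilde X_n)\longrightarrow\begin{cases}G_{\mu_X}^{-1}(1/\theta_{r-j})&\text{if }\theta_{r-j}<1/G_{\mu_X}(a^-),\\ a&\text{otherwise;}\end{cases}$$ (4) for each fixed $j\ge r-s$, almost surely $\lambda_{n-j}(\widetilde X_n)\to a$. -/

import Mathlib

open MeasureTheory ProbabilityTheory Filter Topology
open scoped NNReal ENNReal

noncomputable section

namespace SpikedModel

/-- Matrices carry the product (entrywise) sigma-algebra. -/
instance instMeasurableSpaceMatrix {m n α : Type*} [MeasurableSpace α] :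
    MeasurableSpace (Matrix m n α) :=
  inferInstanceAs (MeasurableSpace (m → n → α))

/-- `lam hA k` is the `k`-th largest eigenvalue of the `n × n` Hermitian matrix `A`, counted with
multiplicity, for `1 ≤ k ≤ n`; outside that range of indices it is `0`. -/
def lam {𝕜 : Type*} [RCLike 𝕜] {n : ℕ} {A : Matrix (Fin n) (Fin n) 𝕜} (hA : A.IsHermitian)
    (k : ℕ) : ℝ :=
  if h : 1 ≤ k ∧ k ≤ n then
    hA.eigenvalues₀ ⟨k - 1, by rw [Fintype.card_fin]; omega⟩
  else 0

/-- The empirical eigenvalue distribution `(1/n) ∑ₖ δ_{λₖ(A)}` (the zero measure if `n = 0`). -/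
def empiricalSpectralMeasure {𝕜 : Type*} [RCLike 𝕜] {n : ℕ} {A : Matrix (Fin n) (Fin n) 𝕜}
    (hA : A.IsHermitian) : FiniteMeasure ℝ :=
  (n : ℝ≥0)⁻¹ • ∑ k ∈ Finset.Icc 1 n, (diracProba (lam hA k)).toFiniteMeasure

/-- The law of the random matrix `M` is invariant under conjugation by every unitary matrix over
`𝕜` (for `𝕜 = ℝ`: by every orthogonal matrix). -/
def IsConjInvariant {Ω 𝕜 : Type*} [MeasurableSpace Ω] [RCLike 𝕜] {n : ℕ}
    (M : Ω → Matrix (Fin n) (Fin n) 𝕜) (Pr : Measure Ω) : Prop :=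
  ∀ U ∈ Matrix.unitaryGroup (Fin n) 𝕜, Pr.map (fun ω => U * M ω * star U) = Pr.map M

/-- The Cauchy transform `G_μ(z) = ∫ 1/(z - t) dμ(t)` at real points `z` off the support. -/
def cauchyTransform (μ : Measure ℝ) (z : ℝ) : ℝ := ∫ t, 1 / (z - t) ∂μ

/-- `G_μ(c⁺)`, the limit of `G_μ(z)` as `z ↓ c`, in the extended reals. -/
def cauchyRight (μ : Measure ℝ) (c : ℝ) : EReal :=
  Function.rightLim (fun z => (cauchyTransform μ z : EReal)) c

/-- `G_μ(c⁻)`, the limit of `G_μ(z)` as `z ↑ c`, in the extended reals. -/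
def cauchyLeft (μ : Measure ℝ) (c : ℝ) : EReal :=
  Function.leftLim (fun z => (cauchyTransform μ z : EReal)) c

/-- `G_μ⁻¹`: the inverse of `G_μ` restricted to the complement `(-∞, a) ∪ (b, ∞)` of the convex
hull `[a, b]` of the support of `μ`. There `G_μ` is injective, negative on the left component and
positive on the right one, with image `(G_μ(a⁻), 0) ∪ (0, G_μ(b⁺))`. -/
def cauchyInverse (μ : Measure ℝ) (y : ℝ) : ℝ :=
  Function.invFunOn (cauchyTransform μ) (convexHull ℝ μ.support)ᶜ y

end SpikedModel

end

open SpikedModel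

/-! Write `P = ∑ θⱼ uⱼ uⱼ*` with orthonormal `uⱼ`, let `Θ` be the diagonal matrix of the `θⱼ`, and
for `z` above the spectrum of `X` let `K(z)` be the `r × r` matrix of the inner products `⟨uᵢ, (z -
X)⁻¹ uⱼ⟩`. The position of the eigenvalues of `X + P` relative to `z` can be read off from `K(z)`.
On vectors `(z - X)⁻¹ ∑ cⱼ uⱼ` the form of `X + P - z` is the form of `KΘK - K` at `c`. Conversely,
completing a square shows that the positive part of `P` is dominated by `z - X` off the span of
finitely many `uⱼ` once `Θ - ΘKΘ` is nonnegative on the remaining positive spikes. If `K(z)` tends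
to `G(z)` times the identity, both matrices become diagonal in the limit, with entries `G(θG - 1)`
and `θ(1 - θG)`. So the spike `θ` pushes an eigenvalue beyond `z` exactly when `θ G(z) > 1`, and its
limit solves `G(ρ) = 1/θ` if such a `ρ` exists (`tendsto_lam_add`). Otherwise the eigenvalue sticks
to the edge: from below because a rank `r` perturbation shifts indices by at most `r` and every
fixed top eigenvalue of `X` tends to `b`.

The probabilistic content is the convergence of `K(z)`. The normalized trace of the resolvent tends
to `G(z)` by weak convergence, so what remains is the compression to the spikes of the centered
resolvent. Independence and invariance allow `P` to be conjugated by a Haar unitary at no cost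
(`lintegral_truncStat_le`), and the entries become `∑ aᵢ conj((Vu)ᵢ) (Vu')ᵢ` with `∑ aᵢ = 0` and
bounded oscillation of `a`. Their fourth moments are `O(n⁻²)`: a sign-averaging argument of
Khintchine type bounds the eighth moments of the coordinates of `Vu`, and an exchangeable-pair
argument (`integral_weighted_pow_four_le`) turns these into the fourth moment of the weighted sum.
Since `n⁻²` is summable, convergence is almost sure. The entries are controlled through the single
scalar `spikeStat`, polynomial in `P`, so no measurable choice of eigenvectors is needed.

The lower edge follows by applying the upper one to `-X` and `-P`. -/

namespace SpikedModel

open Matrix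

/-! ### Sorted eigenvalues and one-sided Courant–Fischer bounds. -/

section Variational

variable {𝕜 : Type*} [RCLike 𝕜] {n : ℕ} {A : Matrix (Fin n) (Fin n) 𝕜}

theorem lam_apply (hA : A.IsHermitian) (i : Fin n) :
    lam hA (i + 1) = hA.eigenvalues₀ (Fin.cast (Fintype.card_fin n).symm i) := by
  have h : 1 ≤ (i : ℕ) + 1 ∧ (i : ℕ) + 1 ≤ n := ⟨by omega, i.2⟩
  rw [lam, dif_pos h]
  rfl

theorem lam_congr {B : Matrix (Fin n) (Fin n) 𝕜} (hA : A.IsHermitian) (hB : B.IsHermitian)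
    (h : A = B) (k : ℕ) : lam hA k = lam hB k := by
  subst h
  rfl

theorem lam_antitone (hA : A.IsHermitian) {k l : ℕ} (hk : 1 ≤ k) (hkl : k ≤ l) (hl : l ≤ n) :
    lam hA l ≤ lam hA k := by
  rw [lam, dif_pos ⟨hk.trans hkl, hl⟩, lam, dif_pos ⟨hk, hkl.trans hl⟩]
  exact hA.eigenvalues₀_antitone (by simp only [Fin.mk_le_mk]; omega)

theorem exists_sorted_eigenbasis (hA : A.IsHermitian) :
    ∃ e : OrthonormalBasis (Fin n) 𝕜 (EuclideanSpace 𝕜 (Fin n)),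
      ∀ i, A.toEuclideanLin (e i) = (lam hA (i + 1) : 𝕜) • e i := by
  refine ⟨((isSymmetric_toEuclideanLin_iff.mpr hA).eigenvectorBasis
    finrank_euclideanSpace).reindex (finCongr (Fintype.card_fin n)), fun i => ?_⟩
  rw [OrthonormalBasis.reindex_apply, LinearMap.IsSymmetric.apply_eigenvectorBasis, lam_apply]
  rfl

theorem sum_lam (hA : A.IsHermitian) (f : ℝ → ℝ) :
    ∑ k ∈ Finset.Icc 1 n, f (lam hA k) = ∑ i : Fin n, f (lam hA (i + 1)) := by
  rw [Fin.sum_univ_eq_sum_range (fun i => f (lam hA (i + 1))), Finset.range_eq_Ico,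
    Finset.sum_Ico_add' (fun i => f (lam hA i)) 0 n 1]
  rfl

/-- The Hermitian form of a matrix. -/
noncomputable def hform (A : Matrix (Fin n) (Fin n) 𝕜) (w : EuclideanSpace 𝕜 (Fin n)) : ℝ :=
  RCLike.re (inner 𝕜 w (A.toEuclideanLin w))

theorem hform_add (A B : Matrix (Fin n) (Fin n) 𝕜) (w : EuclideanSpace 𝕜 (Fin n)) :
    hform (A + B) w = hform A w + hform B w := by
  simp [hform, inner_add_right]

theorem hform_neg (A : Matrix (Fin n) (Fin n) 𝕜) (w : EuclideanSpace 𝕜 (Fin n)) :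
    hform (-A) w = - hform A w := by
  simp [hform]

theorem hform_eq_sum (e : OrthonormalBasis (Fin n) 𝕜 (EuclideanSpace 𝕜 (Fin n))) (d : Fin n → ℝ)
    (h : ∀ i, A.toEuclideanLin (e i) = (d i : 𝕜) • e i) (w : EuclideanSpace 𝕜 (Fin n)) :
    hform A w = ∑ i, d i * ‖inner 𝕜 (e i) w‖ ^ 2 := by
  have h1 : A.toEuclideanLin w = ∑ i, ((d i : 𝕜) * inner 𝕜 (e i) w) • e i := by
    conv_lhs => rw [← e.sum_repr' w, map_sum]
    refine Finset.sum_congr rfl fun i _ => ?_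
    rw [map_smul, h, smul_smul, mul_comm]
  rw [hform, h1, inner_sum, map_sum]
  refine Finset.sum_congr rfl fun i _ => ?_
  rw [inner_smul_right, mul_assoc, RCLike.re_ofReal_mul, ← inner_conj_symm w (e i),
    RCLike.mul_conj]
  norm_cast

theorem inner_eq_zero_of_mem_span {ι : Type*} {E : Type*} [NormedAddCommGroup E]
    [InnerProductSpace 𝕜 E] {e : ι → E} (he : Orthonormal 𝕜 e) {s : Set ι} {w : E}
    (hw : w ∈ Submodule.span 𝕜 (e '' s)) {i : ι} (hi : i ∉ s) : inner 𝕜 (e i) w = 0 := by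
  induction hw using Submodule.span_induction with
  | mem x hx =>
    obtain ⟨j, hj, rfl⟩ := hx
    exact he.2 (fun h => hi (h ▸ hj))
  | zero => simp
  | add x y _ _ hx hy => simp [inner_add_right, hx, hy]
  | smul c x _ hx => simp [inner_smul_right, hx]

theorem finrank_span_orthonormal_image {ι : Type*} {E : Type*} [NormedAddCommGroup E]
    [InnerProductSpace 𝕜 E] {e : ι → E} (he : Orthonormal 𝕜 e) (s : Finset ι) :
    Module.finrank 𝕜 (Submodule.span 𝕜 (e '' (s : Set ι))) = s.card := by
  have h : LinearIndependent 𝕜 (fun i : s => e i) :=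
    he.linearIndependent.comp _ Subtype.val_injective
  have := finrank_span_eq_card h
  rw [Fintype.card_coe] at this
  rw [← this, Set.image_eq_range]
  rfl

theorem hform_le_of_mem_span (e : OrthonormalBasis (Fin n) 𝕜 (EuclideanSpace 𝕜 (Fin n)))
    (d : Fin n → ℝ) (h : ∀ i, A.toEuclideanLin (e i) = (d i : 𝕜) • e i) {s : Set (Fin n)} {c : ℝ}
    (hs : ∀ i ∈ s, d i ≤ c) {w : EuclideanSpace 𝕜 (Fin n)}
    (hw : w ∈ Submodule.span 𝕜 (e '' s)) : hform A w ≤ c * ‖w‖ ^ 2 := by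
  rw [hform_eq_sum e d h, ← e.sum_sq_norm_inner_right w, Finset.mul_sum]
  refine Finset.sum_le_sum fun i _ => ?_
  by_cases hi : i ∈ s
  · exact mul_le_mul_of_nonneg_right (hs i hi) (by positivity)
  · simp [inner_eq_zero_of_mem_span e.orthonormal hw hi]

theorem le_hform_of_mem_span (e : OrthonormalBasis (Fin n) 𝕜 (EuclideanSpace 𝕜 (Fin n)))
    (d : Fin n → ℝ) (h : ∀ i, A.toEuclideanLin (e i) = (d i : 𝕜) • e i) {s : Set (Fin n)} {c : ℝ}
    (hs : ∀ i ∈ s, c ≤ d i) {w : EuclideanSpace 𝕜 (Fin n)}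
    (hw : w ∈ Submodule.span 𝕜 (e '' s)) : c * ‖w‖ ^ 2 ≤ hform A w := by
  rw [hform_eq_sum e d h, ← e.sum_sq_norm_inner_right w, Finset.mul_sum]
  refine Finset.sum_le_sum fun i _ => ?_
  by_cases hi : i ∈ s
  · exact mul_le_mul_of_nonneg_right (hs i hi) (by positivity)
  · simp [inner_eq_zero_of_mem_span e.orthonormal hw hi]

theorem exists_ne_zero_mem_inf {E : Type*} [AddCommGroup E] [Module 𝕜 E] [FiniteDimensional 𝕜 E]
    (V W : Submodule 𝕜 E) (h : Module.finrank 𝕜 E < Module.finrank 𝕜 V + Module.finrank 𝕜 W) :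
    ∃ w ∈ V, w ∈ W ∧ w ≠ 0 := by
  have h1 := Submodule.finrank_sup_add_finrank_inf_eq V W
  have h2 := Submodule.finrank_le (V ⊔ W)
  have h3 : V ⊓ W ≠ ⊥ := by
    intro h4
    rw [h4, finrank_bot] at h1
    omega
  obtain ⟨w, hw, hw0⟩ := Submodule.exists_mem_ne_zero_of_ne_bot h3
  exact ⟨w, hw.1, hw.2, hw0⟩

/-- The easy half of the Courant–Fischer principle, from below. -/
theorem le_lam_of_forall_mem (hA : A.IsHermitian) {k : ℕ} (hk : 1 ≤ k) {z : ℝ}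
    (W : Submodule 𝕜 (EuclideanSpace 𝕜 (Fin n))) (hW : k ≤ Module.finrank 𝕜 W)
    (h : ∀ w ∈ W, z * ‖w‖ ^ 2 ≤ hform A w) : z ≤ lam hA k := by
  obtain ⟨e, he⟩ := exists_sorted_eigenbasis hA
  have hkn : k ≤ n := by
    have := Submodule.finrank_le W
    rw [finrank_euclideanSpace_fin] at this
    omega
  -- The eigenvector `e i` belongs to `lam hA (i + 1)`, so the final segment starting at `k - 1`
  -- spans a space of dimension `n - k + 1`, which must meet `W`.
  have hcard := finrank_span_orthonormal_image e.orthonormal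
    (Finset.Ici (⟨k - 1, by omega⟩ : Fin n))
  rw [Fin.card_Ici] at hcard
  obtain ⟨w, hw1, hw2, hw0⟩ := exists_ne_zero_mem_inf W _
    (by rw [hcard, finrank_euclideanSpace_fin]; simp only; omega)
  have h1 := hform_le_of_mem_span (A := A) e _ he (c := lam hA k) (fun i hi => by
    refine lam_antitone hA hk ?_ i.2
    have : k - 1 ≤ (i : ℕ) := by simpa [Fin.le_def] using hi
    omega) hw2
  have h2 : 0 < ‖w‖ ^ 2 := by positivity
  exact le_of_mul_le_mul_right ((h w hw1).trans h1) h2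

/-- The easy half of the Courant–Fischer principle, from above. -/
theorem lam_le_of_forall_mem (hA : A.IsHermitian) {k : ℕ} (hk : 1 ≤ k) (hkn : k ≤ n) {z : ℝ}
    (W : Submodule 𝕜 (EuclideanSpace 𝕜 (Fin n))) (hW : n < Module.finrank 𝕜 W + k)
    (h : ∀ w ∈ W, hform A w ≤ z * ‖w‖ ^ 2) : lam hA k ≤ z := by
  obtain ⟨e, he⟩ := exists_sorted_eigenbasis hA
  have hcard := finrank_span_orthonormal_image e.orthonormal
    (Finset.Iic (⟨k - 1, by omega⟩ : Fin n))
  rw [Fin.card_Iic] at hcard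
  obtain ⟨w, hw1, hw2, hw0⟩ := exists_ne_zero_mem_inf W _
    (by rw [hcard, finrank_euclideanSpace_fin]; simp only; omega)
  have h1 := le_hform_of_mem_span (A := A) e _ he (c := lam hA k) (fun i hi => by
    have : (i : ℕ) ≤ k - 1 := by simpa [Fin.le_def] using hi
    refine lam_antitone hA (by omega) (by omega) hkn) hw2
  have h2 : 0 < ‖w‖ ^ 2 := by positivity
  exact le_of_mul_le_mul_right (h1.trans (h w hw1)) h2

theorem hform_le_lam_one (hA : A.IsHermitian) (w : EuclideanSpace 𝕜 (Fin n)) :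
    hform A w ≤ lam hA 1 * ‖w‖ ^ 2 := by
  obtain ⟨e, he⟩ := exists_sorted_eigenbasis hA
  refine hform_le_of_mem_span (A := A) e _ he (s := Set.univ)
    (fun i _ => lam_antitone hA le_rfl (by omega) i.2) ?_
  rw [Set.image_univ]
  have := e.toBasis.span_eq
  rw [OrthonormalBasis.coe_toBasis] at this
  rw [this]
  trivial

/-- The last `k` eigenvectors of `A` serve as a test space for `-A`; the reverse inequality in
`lam_neg` tests on the first `n - k + 1`. -/
theorem le_lam_neg (hA : A.IsHermitian) {k : ℕ} (hk : 1 ≤ k) (hkn : k ≤ n) :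
    - lam hA (n + 1 - k) ≤ lam hA.neg k := by
  obtain ⟨e, he⟩ := exists_sorted_eigenbasis hA
  have hcard := finrank_span_orthonormal_image e.orthonormal
    (Finset.Ici (⟨n - k, by omega⟩ : Fin n))
  rw [Fin.card_Ici] at hcard
  refine le_lam_of_forall_mem hA.neg hk _ (by rw [hcard]; simp only; omega) fun w hw => ?_
  have h1 := hform_le_of_mem_span (A := A) e _ he (c := lam hA (n + 1 - k)) (fun i hi => by
    refine lam_antitone hA (by omega) ?_ i.2
    have : n - k ≤ (i : ℕ) := by simpa [Fin.le_def] using hi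
    omega) hw
  rw [hform_neg]
  linarith

theorem lam_neg (hA : A.IsHermitian) {k : ℕ} (hk : 1 ≤ k) (hkn : k ≤ n) :
    lam hA.neg k = - lam hA (n + 1 - k) := by
  refine le_antisymm ?_ (le_lam_neg hA hk hkn)
  obtain ⟨e, he⟩ := exists_sorted_eigenbasis hA
  have hcard := finrank_span_orthonormal_image e.orthonormal
    (Finset.Iic (⟨n - k, by omega⟩ : Fin n))
  rw [Fin.card_Iic] at hcard
  refine lam_le_of_forall_mem hA.neg hk hkn _ (by rw [hcard]; simp only; omega) fun w hw => ?_
  have h1 := le_hform_of_mem_span (A := A) e _ he (c := lam hA (n + 1 - k)) (fun i hi => by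
    have : (i : ℕ) ≤ n - k := by simpa [Fin.le_def] using hi
    exact lam_antitone hA (by omega) (by omega) (by omega)) hw
  rw [hform_neg]
  linarith

end Variational

end SpikedModel

namespace SpikedModel

open Matrix ComplexConjugate

/-! ### Finite-rank perturbation: eigenvalue bounds from compressed resolvents. -/

section Perturbation

variable {𝕜 : Type*} [RCLike 𝕜]

/-- The limiting form is at least `min d · ∑ |cᵢ|²`. Once every entry is within `min d / N` of its
limit, where `N` is the size, the error is at most `(min d / N) (∑ |cᵢ|)²`, which Cauchy–Schwarz
bounds by the same quantity. The threshold does not depend on `c`. -/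
theorem eventually_re_form_nonneg {α ι : Type*} [Fintype ι] [DecidableEq ι] {l : Filter α}
    (M : α → ι → ι → 𝕜) (d : ι → ℝ) (hd : ∀ i, 0 < d i)
    (hM : ∀ i j, Tendsto (fun x => M x i j) l (𝓝 (if i = j then (d i : 𝕜) else 0))) :
    ∀ᶠ x in l, ∀ c : ι → 𝕜, 0 ≤ RCLike.re (∑ i, ∑ j, conj (c i) * M x i j * c j) := by
  rcases isEmpty_or_nonempty ι with h | h
  · simp
  obtain ⟨i₀, hi₀⟩ := Finite.exists_min d
  set N : ℝ := (Fintype.card ι : ℝ) with hN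
  have hN0 : 0 < N := by simp [hN, Fintype.card_pos]
  have hε : 0 < d i₀ / N := div_pos (hd i₀) hN0
  have h1 : ∀ᶠ x in l, ∀ i j, ‖M x i j - (if i = j then (d i : 𝕜) else 0)‖ < d i₀ / N := by
    simp only [eventually_all]
    intro i j
    have := Metric.tendsto_nhds.mp (hM i j) _ hε
    simpa only [dist_eq_norm] using this
  filter_upwards [h1] with x hx c
  have hsplit : ∑ i, ∑ j, conj (c i) * M x i j * c j = ((∑ i, d i * ‖c i‖ ^ 2 : ℝ) : 𝕜)
      + ∑ i, ∑ j, conj (c i) * (M x i j - (if i = j then (d i : 𝕜) else 0)) * c j := by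
    have h2 : ((∑ i, d i * ‖c i‖ ^ 2 : ℝ) : 𝕜)
        = ∑ i, ∑ j, conj (c i) * (if i = j then (d i : 𝕜) else 0) * c j := by
      push_cast
      refine Finset.sum_congr rfl fun i _ => ?_
      rw [Finset.sum_eq_single i]
      · rw [if_pos rfl, ← RCLike.conj_mul]
        ring
      · intro j _ hj
        simp [Ne.symm hj]
      · simp
    rw [h2, ← Finset.sum_add_distrib]
    refine Finset.sum_congr rfl fun i _ => ?_
    rw [← Finset.sum_add_distrib]
    refine Finset.sum_congr rfl fun j _ => ?_
    ring
  rw [hsplit, map_add, RCLike.ofReal_re]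
  set err := ∑ i, ∑ j, conj (c i) * (M x i j - (if i = j then (d i : 𝕜) else 0)) * c j with herr
  have h3 : ‖err‖ ≤ d i₀ / N * (∑ i, ‖c i‖) ^ 2 := by
    rw [sq, Finset.sum_mul_sum, Finset.mul_sum]
    refine (norm_sum_le _ _).trans (Finset.sum_le_sum fun i _ => ?_)
    rw [Finset.mul_sum]
    refine (norm_sum_le _ _).trans (Finset.sum_le_sum fun j _ => ?_)
    rw [norm_mul, norm_mul, RCLike.norm_conj]
    have := mul_le_mul_of_nonneg_right (hx i j).le (mul_nonneg (norm_nonneg (c i))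
      (norm_nonneg (c j)))
    linarith
  have h4 : (∑ i, ‖c i‖) ^ 2 ≤ N * ∑ i, ‖c i‖ ^ 2 := by
    have := sq_sum_le_card_mul_sum_sq (s := Finset.univ) (f := fun i => ‖c i‖)
    simpa [hN] using this
  have h5 : d i₀ * ∑ i, ‖c i‖ ^ 2 ≤ ∑ i, d i * ‖c i‖ ^ 2 := by
    rw [Finset.mul_sum]
    exact Finset.sum_le_sum fun i _ => mul_le_mul_of_nonneg_right (hi₀ i) (by positivity)
  have h6 : d i₀ / N * (∑ i, ‖c i‖) ^ 2 ≤ d i₀ * ∑ i, ‖c i‖ ^ 2 := by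
    calc d i₀ / N * (∑ i, ‖c i‖) ^ 2 ≤ d i₀ / N * (N * ∑ i, ‖c i‖ ^ 2) :=
          mul_le_mul_of_nonneg_left h4 hε.le
      _ = _ := by field_simp
  have h7 := neg_le_of_abs_le (RCLike.abs_re_le_norm err)
  linarith

variable {E : Type*} [NormedAddCommGroup E] [InnerProductSpace 𝕜 E]

/-- Here `D` plays `z - X` and `R` its inverse. Because `D` sends a combination of the `R u` back to
one of the `u`, everything is expressed by the matrix `K` of the `⟨uᵢ, R uⱼ⟩`, and the result is the
form of `KΘK - K`. This gives the lower bounds on eigenvalues. -/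
theorem sum_mul_sq_sub_form_eq {ι κ : Type*} [Fintype ι] [Fintype κ] (D R : E →ₗ[𝕜] E)
    (hDR : ∀ v, D (R v) = v) (hR : R.IsSymmetric) (u : ι → E) (θ : ι → ℝ) (f : κ → ι)
    (c : κ → 𝕜) :
    ∑ l, θ l * ‖inner 𝕜 (u l) (∑ i, c i • R (u (f i)))‖ ^ 2
      - RCLike.re (inner 𝕜 (∑ i, c i • R (u (f i))) (D (∑ i, c i • R (u (f i)))))
    = RCLike.re (∑ i, ∑ j, conj (c i) * (∑ l, (θ l : 𝕜) * inner 𝕜 (u (f i)) (R (u l))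
        * inner 𝕜 (u l) (R (u (f j))) - inner 𝕜 (u (f i)) (R (u (f j)))) * c j) := by
  set w := ∑ i, c i • R (u (f i)) with hw
  have h1 : D w = ∑ j, c j • u (f j) := by
    rw [hw, map_sum]
    exact Finset.sum_congr rfl fun i _ => by rw [map_smul, hDR]
  have h2 : inner 𝕜 w (D w) = ∑ i, ∑ j, conj (c i) * inner 𝕜 (u (f i)) (R (u (f j))) * c j := by
    rw [h1, hw, sum_inner]
    refine Finset.sum_congr rfl fun i _ => ?_
    rw [inner_sum]
    refine Finset.sum_congr rfl fun j _ => ?_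
    rw [inner_smul_left, inner_smul_right, hR]
    ring
  have h3 : ∀ l, ((‖inner 𝕜 (u l) w‖ ^ 2 : ℝ) : 𝕜) = ∑ i, ∑ j, conj (c i) *
      (inner 𝕜 (u (f i)) (R (u l)) * inner 𝕜 (u l) (R (u (f j)))) * c j := by
    intro l
    push_cast
    rw [← RCLike.conj_mul, hw, inner_sum, map_sum, Finset.sum_mul_sum]
    refine Finset.sum_congr rfl fun i _ => Finset.sum_congr rfl fun j _ => ?_
    rw [inner_smul_right, inner_smul_right, map_mul, inner_conj_symm, hR]
    ring
  have h4 : ((∑ l, θ l * ‖inner 𝕜 (u l) w‖ ^ 2 : ℝ) : 𝕜) - inner 𝕜 w (D w)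
    = (∑ i, ∑ j, conj (c i) * (∑ l, (θ l : 𝕜) * inner 𝕜 (u (f i)) (R (u l))
        * inner 𝕜 (u l) (R (u (f j))) - inner 𝕜 (u (f i)) (R (u (f j)))) * c j) := by
    have h5 : ((∑ l, θ l * ‖inner 𝕜 (u l) w‖ ^ 2 : ℝ) : 𝕜) =
        ∑ l, (θ l : 𝕜) * ((‖inner 𝕜 (u l) w‖ ^ 2 : ℝ) : 𝕜) := by
      push_cast
      rfl
    rw [h2, h5]
    simp_rw [h3, mul_sub, sub_mul, Finset.sum_sub_distrib, Finset.mul_sum, Finset.sum_mul]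
    congr 1
    rw [Finset.sum_comm]
    refine Finset.sum_congr rfl fun i _ => ?_
    rw [Finset.sum_comm]
    refine Finset.sum_congr rfl fun j _ => Finset.sum_congr rfl fun l _ => ?_
    ring
  rw [← h4, map_sub, RCLike.ofReal_re]

/-- Completing the square. With `y = ∑ θⱼ ⟨uⱼ, w⟩ uⱼ` and `q` the left-hand sum, positivity of `D`
at `w - R y` reads `⟨w, D w⟩ ≥ 2q - ⟨y, R y⟩`, while `hN` at the coefficients `⟨uⱼ, w⟩` says `⟨y, R
y⟩ ≤ q`. This gives the upper bounds on eigenvalues. -/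
theorem sum_mul_sq_le_form {ι : Type*} [DecidableEq ι] (D R : E →ₗ[𝕜] E)
    (hDR : ∀ v, D (R v) = v) (hD : D.IsSymmetric) (hR : R.IsSymmetric)
    (hpos : ∀ v, 0 ≤ RCLike.re (inner 𝕜 v (D v)))
    (u : ι → E) (θ : ι → ℝ) (J : Finset ι)
    (hN : ∀ c : J → 𝕜, 0 ≤ RCLike.re (∑ i : J, ∑ j : J, conj (c i) *
      ((if i = j then (θ i : 𝕜) else 0) - θ i * θ j * inner 𝕜 (u i) (R (u j))) * c j)) (w : E) :
    ∑ j ∈ J, θ j * ‖inner 𝕜 (u j) w‖ ^ 2 ≤ RCLike.re (inner 𝕜 w (D w)) := by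
  set c : J → 𝕜 := fun j => inner 𝕜 (u j) w with hc
  set y : E := ∑ j : J, ((θ j : 𝕜) * c j) • u j with hy
  set q : ℝ := ∑ j : J, θ j * ‖c j‖ ^ 2 with hq
  have hq' : ∑ j ∈ J, θ j * ‖inner 𝕜 (u j) w‖ ^ 2 = q := by
    rw [← Finset.sum_coe_sort]
  have h1 : inner 𝕜 y w = (q : 𝕜) := by
    rw [hy, hq, sum_inner]
    push_cast
    refine Finset.sum_congr rfl fun j _ => ?_
    rw [inner_smul_left, map_mul, RCLike.conj_ofReal, mul_assoc, ← RCLike.conj_mul]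
  have h2 : inner 𝕜 y (R y) = ∑ i : J, ∑ j : J, conj (c i) *
      (θ i * θ j * inner 𝕜 (u i) (R (u j))) * c j := by
    conv_lhs => rw [hy, map_sum, sum_inner]
    refine Finset.sum_congr rfl fun i _ => ?_
    rw [inner_sum]
    refine Finset.sum_congr rfl fun j _ => ?_
    rw [map_smul, inner_smul_left, inner_smul_right, map_mul, RCLike.conj_ofReal]
    ring
  have h3 : (q : 𝕜) = ∑ i : J, ∑ j : J, conj (c i) * (if i = j then (θ i : 𝕜) else 0) * c j := by
    rw [hq]
    push_cast
    refine Finset.sum_congr rfl fun i _ => ?_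
    rw [Finset.sum_eq_single i]
    · rw [if_pos rfl, ← RCLike.conj_mul]
      ring
    · intro j _ hj
      simp [Ne.symm hj]
    · simp
  have h4 : 0 ≤ q - RCLike.re (inner 𝕜 y (R y)) := by
    have := hN c
    simp_rw [mul_sub, sub_mul, Finset.sum_sub_distrib] at this
    rw [← h3, map_sub, RCLike.ofReal_re] at this
    rwa [h2]
  have h5 := hpos (w - R y)
  have h6 : inner 𝕜 (w - R y) (D (w - R y)) =
      inner 𝕜 w (D w) - inner 𝕜 w y - inner 𝕜 y w + inner 𝕜 y (R y) := by
    rw [map_sub, hDR, inner_sub_left, inner_sub_right, inner_sub_right, ← hD (R y) w, hDR, hR y y]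
    ring
  rw [h6, map_add, map_sub, map_sub, inner_re_symm w y, h1, RCLike.ofReal_re] at h5
  rw [hq']
  linarith

variable {n r : ℕ} {X P : Matrix (Fin n) (Fin n) 𝕜}

/-- `P = ∑ⱼ θⱼ uⱼ uⱼ*` with orthonormal `uⱼ`. -/
def HasSpikes (P : Matrix (Fin n) (Fin n) 𝕜) (θ : Fin r → ℝ)
    (u : Fin r → EuclideanSpace 𝕜 (Fin n)) : Prop :=
  Orthonormal 𝕜 u ∧ ∀ w, P.toEuclideanLin w = ∑ j, ((θ j : 𝕜) * inner 𝕜 (u j) w) • u j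

theorem HasSpikes.hform {θ : Fin r → ℝ} {u : Fin r → EuclideanSpace 𝕜 (Fin n)}
    (h : HasSpikes P θ u) (w : EuclideanSpace 𝕜 (Fin n)) :
    hform P w = ∑ j, θ j * ‖inner 𝕜 (u j) w‖ ^ 2 := by
  rw [SpikedModel.hform, h.2, inner_sum, map_sum]
  refine Finset.sum_congr rfl fun j _ => ?_
  rw [inner_smul_right, mul_assoc, RCLike.re_ofReal_mul, ← inner_conj_symm w (u j),
    RCLike.mul_conj]
  norm_cast

/-- The linear map `z - X`. -/
noncomputable def shift (X : Matrix (Fin n) (Fin n) 𝕜) (z : ℝ) :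
    EuclideanSpace 𝕜 (Fin n) →ₗ[𝕜] EuclideanSpace 𝕜 (Fin n) :=
  ((z : 𝕜) • (1 : Matrix (Fin n) (Fin n) 𝕜) - X).toEuclideanLin

theorem shift_apply (X : Matrix (Fin n) (Fin n) 𝕜) (z : ℝ) (w : EuclideanSpace 𝕜 (Fin n)) :
    shift X z w = (z : 𝕜) • w - X.toEuclideanLin w := by
  rw [shift, map_sub, map_smul, Matrix.toLpLin_one]
  rfl

theorem re_inner_shift (X : Matrix (Fin n) (Fin n) 𝕜) (z : ℝ) (w : EuclideanSpace 𝕜 (Fin n)) :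
    RCLike.re (inner 𝕜 w (shift X z w)) = z * ‖w‖ ^ 2 - hform X w := by
  rw [shift_apply, inner_sub_right, map_sub, inner_smul_right, RCLike.re_ofReal_mul, hform,
    inner_self_eq_norm_sq]

theorem isSymmetric_shift (hX : X.IsHermitian) (z : ℝ) : (shift X z).IsSymmetric := by
  rw [shift, isSymmetric_toEuclideanLin_iff]
  refine IsHermitian.sub ?_ hX
  simp [IsHermitian, conjTranspose_smul]

/-- The test space is spanned by the `R uⱼ` with `j ∈ J`; these stay independent because `z - X`
inverts `R`. -/
theorem le_lam_add_of_form_nonneg (hX : X.IsHermitian) (hP : P.IsHermitian) {θ : Fin r → ℝ}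
    {u : Fin r → EuclideanSpace 𝕜 (Fin n)} (hu : HasSpikes P θ u) {z : ℝ}
    {R : EuclideanSpace 𝕜 (Fin n) →ₗ[𝕜] EuclideanSpace 𝕜 (Fin n)}
    (hDR : ∀ v, shift X z (R v) = v) (hR : R.IsSymmetric) {J : Finset (Fin r)} (hJ : 1 ≤ J.card)
    (hM : ∀ c : J → 𝕜, 0 ≤ RCLike.re (∑ i : J, ∑ j : J, conj (c i) *
      (∑ l, (θ l : 𝕜) * inner 𝕜 (u i) (R (u l)) * inner 𝕜 (u l) (R (u j))
        - inner 𝕜 (u i) (R (u j))) * c j)) :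
    z ≤ lam (hX.add hP) J.card := by
  have hinj : Function.Injective R := Function.LeftInverse.injective hDR
  have hli : LinearIndependent 𝕜 (fun j : J => R (u j)) :=
    (hu.1.linearIndependent.comp _ Subtype.val_injective).map' R (LinearMap.ker_eq_bot.mpr hinj)
  refine le_lam_of_forall_mem _ hJ (Submodule.span 𝕜 (Set.range fun j : J => R (u j))) ?_ ?_
  · rw [finrank_span_eq_card hli, Fintype.card_coe]
  · intro w hw
    obtain ⟨c, rfl⟩ := (Submodule.mem_span_range_iff_exists_fun 𝕜).mp hw
    have h1 := sum_mul_sq_sub_form_eq (shift X z) R hDR hR u θ (fun j : J => (j : Fin r)) c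
    have h2 := hM c
    rw [← h1, re_inner_shift, ← hu.hform] at h2
    rw [hform_add]
    linarith

/-- The test space is the orthogonal complement of the `uⱼ` with `j ∈ J`, of codimension less than
`k`. There the spikes of `J` vanish, the nonpositive ones only help, and those of `J'` are absorbed
by `z - X` through `sum_mul_sq_le_form`. -/
theorem lam_add_le_of_form_nonneg (hX : X.IsHermitian) (hP : P.IsHermitian) {θ : Fin r → ℝ}
    {u : Fin r → EuclideanSpace 𝕜 (Fin n)} (hu : HasSpikes P θ u) {z : ℝ}
    {R : EuclideanSpace 𝕜 (Fin n) →ₗ[𝕜] EuclideanSpace 𝕜 (Fin n)}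
    (hDR : ∀ v, shift X z (R v) = v) (hR : R.IsSymmetric)
    (hXz : ∀ v, hform X v ≤ z * ‖v‖ ^ 2)
    {J J' : Finset (Fin r)} {k : ℕ} (hJ : J.card < k) (hk : k ≤ n)
    (hJJ : ∀ j, j ∈ J ∨ θ j ≤ 0 ∨ j ∈ J')
    (hN : ∀ c : J' → 𝕜, 0 ≤ RCLike.re (∑ i : J', ∑ j : J', conj (c i) *
      ((if i = j then (θ i : 𝕜) else 0) - θ i * θ j * inner 𝕜 (u i) (R (u j))) * c j)) :
    lam (hX.add hP) k ≤ z := by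
  refine lam_le_of_forall_mem _ (by omega) hk
    (Submodule.span 𝕜 (u '' (J : Set (Fin r))))ᗮ ?_ ?_
  · have h1 := Submodule.finrank_add_finrank_orthogonal
      (Submodule.span 𝕜 (u '' (J : Set (Fin r))))
    rw [finrank_span_orthonormal_image hu.1, finrank_euclideanSpace_fin] at h1
    omega
  · intro w hw
    have h0 : ∀ j ∈ J, inner 𝕜 (u j) w = 0 := fun j hj =>
      (Submodule.mem_orthogonal _ _).mp hw _ (Submodule.subset_span ⟨j, hj, rfl⟩)
    have h1 := sum_mul_sq_le_form (shift X z) R hDR (isSymmetric_shift hX z) hR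
      (fun v => by rw [re_inner_shift]; linarith [hXz v]) u θ J' hN w
    have h2 : hform P w ≤ ∑ j ∈ J', θ j * ‖inner 𝕜 (u j) w‖ ^ 2 := by
      rw [hu.hform, ← Finset.sum_add_sum_compl J']
      have : ∑ j ∈ J'ᶜ, θ j * ‖inner 𝕜 (u j) w‖ ^ 2 ≤ 0 := by
        refine Finset.sum_nonpos fun j hj => ?_
        rcases hJJ j with h | h | h
        · simp [h0 j h]
        · exact mul_nonpos_of_nonpos_of_nonneg h (by positivity)
        · exact absurd h (Finset.mem_compl.mp hj)
      linarith
    rw [re_inner_shift] at h1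
    rw [hform_add]
    linarith

/-- Weyl's interlacing: the form of `P` vanishes on the complement of the spikes, which costs at
most `r` dimensions of the span of the top `k + r` eigenvectors of `X`. -/
theorem lam_add_rank_le_lam_add (hX : X.IsHermitian) (hP : P.IsHermitian) {θ : Fin r → ℝ}
    {u : Fin r → EuclideanSpace 𝕜 (Fin n)} (hu : HasSpikes P θ u) {k : ℕ} (hk : 1 ≤ k)
    (hkn : k + r ≤ n) : lam hX (k + r) ≤ lam (hX.add hP) k := by
  obtain ⟨e, he⟩ := exists_sorted_eigenbasis hX
  set V := Submodule.span 𝕜 (e '' ((Finset.Iic (⟨k + r - 1, by omega⟩ : Fin n) : Finset (Fin n)) :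
    Set (Fin n))) with hV
  have hcard : Module.finrank 𝕜 V = k + r := by
    rw [hV, finrank_span_orthonormal_image e.orthonormal, Fin.card_Iic]
    simp only
    omega
  set U := Submodule.span 𝕜 (u '' ((Finset.univ : Finset (Fin r)) : Set (Fin r))) with hU
  have hcardU : Module.finrank 𝕜 U = r := by
    rw [hU, finrank_span_orthonormal_image hu.1, Finset.card_fin]
  refine le_lam_of_forall_mem _ hk (V ⊓ Uᗮ) ?_ ?_
  · have h1 := Submodule.finrank_sup_add_finrank_inf_eq V Uᗮ
    have h2 := Submodule.finrank_le (V ⊔ Uᗮ)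
    have h3 := Submodule.finrank_add_finrank_orthogonal U
    rw [finrank_euclideanSpace_fin] at h2 h3
    omega
  · intro w hw
    have h0 : ∀ j, inner 𝕜 (u j) w = 0 := fun j =>
      (Submodule.mem_orthogonal _ _).mp hw.2 _ (Submodule.subset_span ⟨j, by simp, rfl⟩)
    have h1 := le_hform_of_mem_span (A := X) e _ he (c := lam hX (k + r)) (fun i hi => by
      have : (i : ℕ) ≤ k + r - 1 := by simpa [Fin.le_def] using hi
      exact lam_antitone hX (by omega) (by omega) hkn) hw.1
    rw [hform_add, hu.hform]
    simpa [h0] using h1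

end Perturbation

end SpikedModel

namespace SpikedModel

open Matrix ComplexConjugate

/-! ### Eighth moments of random sign sums. -/

section Khintchine

/-- The vectors of signs. -/
noncomputable def signs (n : ℕ) : Finset (Fin n → ℝ) :=
  Fintype.piFinset fun _ => ({1, -1} : Finset ℝ)

theorem card_signs (n : ℕ) : (signs n).card = 2 ^ n := by
  have : ({1, -1} : Finset ℝ).card = 2 := Finset.card_pair (by norm_num)
  simp [signs, Fintype.card_piFinset, this]

theorem sq_eq_one_of_mem_signs {n : ℕ} {ε : Fin n → ℝ} (h : ε ∈ signs n) (i : Fin n) :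
    ε i ^ 2 = 1 := by
  have := Fintype.mem_piFinset.mp h i
  simp only [Finset.mem_insert, Finset.mem_singleton] at this
  rcases this with h | h <;> simp [h]

/-- The sum over signs factors into `∏ 2 cosh xᵢ`, and `cosh x ≤ exp (x² / 2)`. -/
theorem sum_signs_exp_le {n : ℕ} (x : Fin n → ℝ) :
    ∑ ε ∈ signs n, Real.exp (∑ i, ε i * x i) ≤ 2 ^ n * Real.exp ((∑ i, x i ^ 2) / 2) := by
  have h1 : ∑ ε ∈ signs n, Real.exp (∑ i, ε i * x i) = ∏ i, (2 * Real.cosh (x i)) := by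
    simp_rw [Real.exp_sum]
    rw [signs, ← Finset.prod_univ_sum (fun _ => ({1, -1} : Finset ℝ))
      (fun i e => Real.exp (e * x i))]
    refine Finset.prod_congr rfl fun i _ => ?_
    rw [Finset.sum_pair (by norm_num), Real.cosh_eq]
    simp only [one_mul, neg_mul]
    ring
  rw [h1, Finset.prod_mul_distrib, Finset.prod_const, Finset.card_fin, Finset.sum_div,
    Real.exp_sum]
  exact mul_le_mul_of_nonneg_left (Finset.prod_le_prod (fun i _ => (Real.cosh_pos _).le)
    fun i _ => Real.cosh_le_exp_half_sq _) (by positivity)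

theorem pow_eight_le_exp (t : ℝ) : t ^ 8 ≤ 40320 * (Real.exp t + Real.exp (-t)) := by
  have h : ∀ s : ℝ, 0 ≤ s → s ^ 8 ≤ 40320 * Real.exp s := fun s hs => by
    have := Real.pow_div_factorial_le_exp s hs 8
    rw [div_le_iff₀ (by positivity)] at this
    norm_num [Nat.factorial] at this
    linarith
  rcases le_total 0 t with ht | ht
  · have := h t ht
    linarith [Real.exp_pos (-t)]
  · have := h (-t) (by linarith)
    rw [Even.neg_pow (by decide)] at this
    linarith [Real.exp_pos t]

/-- By homogeneity take `∑ xᵢ² = 1`; then use `t⁸ ≤ 8! (eᵗ + e⁻ᵗ)` and the exponential bound at `x`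
and `-x`. The constant is `161280 = 8! · 2 · 2`, the last factor bounding `exp (1/2)`. -/
theorem sum_signs_pow_eight_le {n : ℕ} (x : Fin n → ℝ) :
    ∑ ε ∈ signs n, (∑ i, ε i * x i) ^ 8 ≤ 2 ^ n * (161280 * (∑ i, x i ^ 2) ^ 4) := by
  have key : ∀ y : Fin n → ℝ, ∑ i, y i ^ 2 = 1 →
      ∑ ε ∈ signs n, (∑ i, ε i * y i) ^ 8 ≤ 2 ^ n * 161280 := by
    intro y hy
    have h1 := sum_signs_exp_le y
    have h2 := sum_signs_exp_le (fun i => - y i)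
    simp only [neg_sq, mul_neg, Finset.sum_neg_distrib] at h2
    have h3 : ∑ ε ∈ signs n, (∑ i, ε i * y i) ^ 8 ≤ ∑ ε ∈ signs n,
        40320 * (Real.exp (∑ i, ε i * y i) + Real.exp (-∑ i, ε i * y i)) :=
      Finset.sum_le_sum fun ε _ => pow_eight_le_exp _
    rw [← Finset.mul_sum, Finset.sum_add_distrib] at h3
    have h4 : Real.exp (1 / 2) ≤ 2 := by
      have h5 := Real.exp_one_lt_d9
      have h6 : Real.exp (1 / 2) * Real.exp (1 / 2) = Real.exp 1 := by
        rw [← Real.exp_add]; norm_num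
      nlinarith [Real.exp_pos (1 / 2 : ℝ)]
    rw [hy] at h1 h2
    have h7 : (0 : ℝ) < 2 ^ n := by positivity
    have h8 := mul_le_mul_of_nonneg_left h4 h7.le
    linarith
  rcases eq_or_ne (∑ i, x i ^ 2) 0 with h0 | h0
  · have : ∀ i, x i = 0 := fun i => by
      have := (Finset.sum_eq_zero_iff_of_nonneg fun i _ => sq_nonneg (x i)).mp h0 i
        (Finset.mem_univ i)
      exact pow_eq_zero_iff (two_ne_zero) |>.mp this
    simp [this]
  · have hpos : 0 < ∑ i, x i ^ 2 := lt_of_le_of_ne (Finset.sum_nonneg fun i _ => sq_nonneg _)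
      (Ne.symm h0)
    set c := Real.sqrt (∑ i, x i ^ 2) with hc
    have hc0 : 0 < c := Real.sqrt_pos.mpr hpos
    have hc2 : c ^ 2 = ∑ i, x i ^ 2 := Real.sq_sqrt hpos.le
    have h1 := key (fun i => x i / c) (by
      simp_rw [div_pow]
      rw [← Finset.sum_div, hc2, div_self h0])
    have h2 : ∀ ε : Fin n → ℝ, (∑ i, ε i * (x i / c)) ^ 8 = (∑ i, ε i * x i) ^ 8 / c ^ 8 := by
      intro ε
      rw [← div_pow, Finset.sum_div]
      congr 1
      exact Finset.sum_congr rfl fun i _ => by ring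
    simp_rw [h2] at h1
    rw [← Finset.sum_div, div_le_iff₀ (by positivity)] at h1
    calc _ ≤ _ := h1
      _ = _ := by rw [← hc2]; ring

variable {𝕜 : Type*} [RCLike 𝕜]

/-- Real and imaginary parts are treated separately; `(s + t)⁴ ≤ 8 (s⁴ + t⁴)` turns `161280` into
`1290240`. -/
theorem sum_signs_norm_pow_eight_le {n : ℕ} (v : Fin n → 𝕜) :
    ∑ ε ∈ signs n, ‖∑ i, (ε i : 𝕜) * v i‖ ^ 8 ≤ 2 ^ n * (1290240 * (∑ i, ‖v i‖ ^ 2) ^ 4) := by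
  set a := ∑ i, RCLike.re (v i) ^ 2 with ha
  set b := ∑ i, RCLike.im (v i) ^ 2 with hb
  have hab : ∑ i, ‖v i‖ ^ 2 = a + b := by
    rw [ha, hb, ← Finset.sum_add_distrib]
    refine Finset.sum_congr rfl fun i _ => ?_
    rw [RCLike.norm_sq_eq_def]
    ring
  have ha0 : 0 ≤ a := Finset.sum_nonneg fun i _ => sq_nonneg _
  have hb0 : 0 ≤ b := Finset.sum_nonneg fun i _ => sq_nonneg _
  have h1 : ∀ ε : Fin n → ℝ, ‖∑ i, (ε i : 𝕜) * v i‖ ^ 8 ≤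
      8 * ((∑ i, ε i * RCLike.re (v i)) ^ 8 + (∑ i, ε i * RCLike.im (v i)) ^ 8) := by
    intro ε
    have h2 : ‖∑ i, (ε i : 𝕜) * v i‖ ^ 2 = (∑ i, ε i * RCLike.re (v i)) ^ 2 +
        (∑ i, ε i * RCLike.im (v i)) ^ 2 := by
      rw [RCLike.norm_sq_eq_def, map_sum, map_sum]
      simp_rw [RCLike.re_ofReal_mul, RCLike.im_ofReal_mul]
      ring
    calc ‖∑ i, (ε i : 𝕜) * v i‖ ^ 8 = (‖∑ i, (ε i : 𝕜) * v i‖ ^ 2) ^ 4 := by ring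
      _ ≤ _ := by
        rw [h2]
        have := add_pow_le (sq_nonneg (∑ i, ε i * RCLike.re (v i)))
          (sq_nonneg (∑ i, ε i * RCLike.im (v i))) 4
        norm_num [← pow_mul] at this ⊢
        linarith
  have h3 := sum_signs_pow_eight_le (fun i => RCLike.re (v i))
  have h4 := sum_signs_pow_eight_le (fun i => RCLike.im (v i))
  have h5 : a ^ 4 + b ^ 4 ≤ (a + b) ^ 4 := by
    have : 0 ≤ 4 * a ^ 3 * b + 6 * a ^ 2 * b ^ 2 + 4 * a * b ^ 3 := by positivity
    nlinarith
  have h6 : (0 : ℝ) < 2 ^ n := by positivity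
  calc _ ≤ ∑ ε ∈ signs n, 8 * ((∑ i, ε i * RCLike.re (v i)) ^ 8 +
        (∑ i, ε i * RCLike.im (v i)) ^ 8) := Finset.sum_le_sum fun ε _ => h1 ε
    _ ≤ 8 * (2 ^ n * (161280 * a ^ 4) + 2 ^ n * (161280 * b ^ 4)) := by
      rw [← Finset.mul_sum, Finset.sum_add_distrib]
      linarith
    _ = 2 ^ n * (1290240 * (a ^ 4 + b ^ 4)) := by ring
    _ ≤ _ := by
      rw [hab]
      exact mul_le_mul_of_nonneg_left (mul_le_mul_of_nonneg_left h5 (by norm_num)) h6.le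

end Khintchine

/-! ### The compact unitary group and its Haar probability measure. -/

section UnitaryGroup

variable {𝕜 : Type*} [RCLike 𝕜] {n : ℕ}

instance instBorelSpaceMatrix : BorelSpace (Matrix (Fin n) (Fin n) 𝕜) :=
  inferInstanceAs (BorelSpace (Fin n → Fin n → 𝕜))

instance instSecondCountableMatrix : SecondCountableTopology (Matrix (Fin n) (Fin n) 𝕜) :=
  inferInstanceAs (SecondCountableTopology (Fin n → Fin n → 𝕜))

instance instCompactSpaceUnitaryGroup : CompactSpace (unitaryGroup (Fin n) 𝕜) := by
  refine isCompact_iff_compactSpace.mp ?_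
  have h1 : IsCompact (Set.pi Set.univ fun _ : Fin n => Set.pi Set.univ fun _ : Fin n =>
      Metric.closedBall (0 : 𝕜) 1) :=
    isCompact_univ_pi fun _ => isCompact_univ_pi fun _ => isCompact_closedBall _ _
  refine IsCompact.of_isClosed_subset (X := Matrix (Fin n) (Fin n) 𝕜) h1 isClosed_unitary ?_
  intro U hU
  exact fun i _ j _ => mem_closedBall_zero_iff.mpr (entry_norm_bound_of_unitary hU i j)

theorem exists_haar_unitaryGroup : ∃ ν : Measure (unitaryGroup (Fin n) 𝕜),
    IsProbabilityMeasure ν ∧ ν.IsMulLeftInvariant :=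
  ⟨Measure.haarMeasure ⊤, ⟨by
    have := Measure.haarMeasure_self (K₀ := (⊤ : TopologicalSpace.PositiveCompacts
      (unitaryGroup (Fin n) 𝕜)))
    simpa using this⟩, inferInstance⟩

theorem exists_unitary_row (i : Fin n) (w : Fin n → 𝕜) (hw : ∑ j, ‖w j‖ ^ 2 = 1) :
    ∃ W : unitaryGroup (Fin n) 𝕜, ∀ j, W.1 i j = w j := by
  have hw' : ‖WithLp.toLp 2 w‖ = 1 := by
    rw [EuclideanSpace.norm_eq]
    simp [hw]
  obtain ⟨b, hb⟩ := Orthonormal.exists_orthonormalBasis_extension_of_card_eq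
    (𝕜 := 𝕜) (E := EuclideanSpace 𝕜 (Fin n)) (ι := Fin n) (by simp)
    (v := fun _ => WithLp.toLp 2 w) (s := {i}) (by
      rw [orthonormal_iff_ite]
      rintro ⟨x, hx⟩ ⟨y, hy⟩
      simp only [Set.mem_singleton_iff] at hx hy
      subst hx hy
      simp only [Set.domRestrict_apply, if_true, inner_self_eq_norm_sq_to_K, hw']
      simp)
  refine ⟨⟨Matrix.of fun k j => b k j, ?_⟩, fun j => ?_⟩
  · rw [mem_unitaryGroup_iff]
    ext k l
    have := orthonormal_iff_ite.mp b.orthonormal l k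
    rw [EuclideanSpace.inner_eq_star_dotProduct] at this
    rw [Matrix.mul_apply, Matrix.one_apply]
    simp only [eq_comm (a := k)]
    rw [← this]
    simp [dotProduct]
  · simp [hb i rfl]

theorem sum_norm_sq_mulVec (V : unitaryGroup (Fin n) 𝕜) (u : Fin n → 𝕜) :
    ∑ i, ‖(V.1 *ᵥ u) i‖ ^ 2 = ∑ i, ‖u i‖ ^ 2 := by
  have h : ∀ v : Fin n → 𝕜, ((∑ i, ‖v i‖ ^ 2 : ℝ) : 𝕜) = star v ⬝ᵥ v := fun v => by
    push_cast
    refine Finset.sum_congr rfl fun i _ => ?_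
    rw [← RCLike.conj_mul]
    rfl
  have h2 : ((∑ i, ‖(V.1 *ᵥ u) i‖ ^ 2 : ℝ) : 𝕜) = ((∑ i, ‖u i‖ ^ 2 : ℝ) : 𝕜) := by
    rw [h, h, star_mulVec, dotProduct_mulVec, vecMul_vecMul, ← star_eq_conjTranspose,
      UnitaryGroup.star_mul_self, vecMul_one]
  exact_mod_cast h2

theorem continuous_mulVec_apply (u : Fin n → 𝕜) (i : Fin n) :
    Continuous fun V : unitaryGroup (Fin n) 𝕜 => (V.1 *ᵥ u) i :=
  (continuous_apply i).comp (continuous_subtype_val.matrix_mulVec continuous_const)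

end UnitaryGroup

/-! ### Moments of the coordinates of a Haar-rotated vector. -/

section Haar

variable {𝕜 : Type*} [RCLike 𝕜] {n : ℕ} (ν : Measure (unitaryGroup (Fin n) 𝕜))
  [IsProbabilityMeasure ν]

theorem integrable_of_continuous {f : unitaryGroup (Fin n) 𝕜 → ℝ} (hf : Continuous f) :
    Integrable f ν :=
  hf.integrable_of_hasCompactSupport (HasCompactSupport.of_compactSpace f)

variable [ν.IsMulLeftInvariant]

/-- Left multiplication by a unitary whose `i`-th row is `ε / √n` preserves Haar measure, so the
moment equals `n⁻⁴ ∫ |∑ εⱼ (Vu)ⱼ|⁸` for every sign vector `ε`. Averaging over `ε` and using `‖Vu‖ =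
‖u‖` leaves only the sign-sum estimate; no explicit Haar integrals are computed. -/
theorem integral_norm_entry_pow_eight_le (u : Fin n → 𝕜) (i : Fin n) :
    ∫ V, ‖(V.1 *ᵥ u) i‖ ^ 8 ∂ν ≤ 1290240 * (∑ i, ‖u i‖ ^ 2) ^ 4 / (n : ℝ) ^ 4 := by
  have hn : (0 : ℝ) < n := by
    have := i.pos
    exact_mod_cast this
  set I := ∫ V, ‖(V.1 *ᵥ u) i‖ ^ 8 ∂ν with hI
  have h1 : ∀ ε ∈ signs n, ∫ V, ‖∑ j, (ε j : 𝕜) * (V.1 *ᵥ u) j‖ ^ 8 ∂ν = (n : ℝ) ^ 4 * I := by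
    intro ε hε
    obtain ⟨W, hW⟩ := exists_unitary_row (𝕜 := 𝕜) i (fun j => ((ε j / √n : ℝ) : 𝕜)) (by
      simp only [RCLike.norm_ofReal, sq_abs, div_pow, sq_eq_one_of_mem_signs hε]
      rw [Finset.sum_const, Finset.card_fin, Real.sq_sqrt hn.le]
      simp [hn.ne'])
    have h2 : ∀ V : unitaryGroup (Fin n) 𝕜, ‖∑ j, (ε j : 𝕜) * (V.1 *ᵥ u) j‖ ^ 8 =
        (n : ℝ) ^ 4 * ‖((W * V).1 *ᵥ u) i‖ ^ 8 := by
      intro V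
      have h3 : ((W * V).1 *ᵥ u) i = ((1 / √n : ℝ) : 𝕜) * ∑ j, (ε j : 𝕜) * (V.1 *ᵥ u) j := by
        rw [UnitaryGroup.mul_val, ← mulVec_mulVec, mulVec, dotProduct, Finset.mul_sum]
        refine Finset.sum_congr rfl fun j _ => ?_
        rw [hW]
        push_cast
        ring
      rw [h3, norm_mul, RCLike.norm_ofReal, abs_of_nonneg (by positivity), mul_pow, div_pow]
      have : √(n : ℝ) ^ 8 = (n : ℝ) ^ 4 := by
        rw [show 8 = 2 * 4 from rfl, pow_mul, Real.sq_sqrt hn.le]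
      rw [this]
      field_simp
    simp_rw [h2]
    rw [integral_const_mul, integral_mul_left_eq_self (fun V => ‖(V.1 *ᵥ u) i‖ ^ 8) W]
  have hcont : ∀ ε : Fin n → ℝ, Continuous fun V : unitaryGroup (Fin n) 𝕜 =>
      ‖∑ j, (ε j : 𝕜) * (V.1 *ᵥ u) j‖ ^ 8 := fun ε =>
    (continuous_finsetSum _ fun j _ =>
      continuous_const.mul (continuous_mulVec_apply u j)).norm.pow 8
  have h4 : ∑ ε ∈ signs n, ∫ V, ‖∑ j, (ε j : 𝕜) * (V.1 *ᵥ u) j‖ ^ 8 ∂ν ≤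
      2 ^ n * (1290240 * (∑ i, ‖u i‖ ^ 2) ^ 4) := by
    rw [← integral_finsetSum _ fun ε _ => integrable_of_continuous ν (hcont ε)]
    calc _ ≤ ∫ _V : unitaryGroup (Fin n) 𝕜, 2 ^ n * (1290240 * (∑ i, ‖u i‖ ^ 2) ^ 4) ∂ν := by
          refine integral_mono (integrable_of_continuous ν
            (continuous_finsetSum _ fun ε _ => hcont ε)) (integrable_const _) fun V => ?_
          have := sum_signs_norm_pow_eight_le (V.1 *ᵥ u)
          rwa [sum_norm_sq_mulVec] at this
      _ = _ := by simp
  rw [Finset.sum_congr rfl h1, Finset.sum_const, card_signs, nsmul_eq_mul] at h4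
  rw [le_div_iff₀ (by positivity)]
  have h5 : (0 : ℝ) < 2 ^ n := by positivity
  push_cast at h4
  have := le_of_mul_le_mul_left h4 h5
  linarith

end Haar

end SpikedModel

namespace SpikedModel

open Matrix ComplexConjugate

/-! ### Fourth moments of centered weighted sums, by exchangeable pairs. -/

section ExchangeablePairs

variable {𝕜 : Type*} [RCLike 𝕜] {n : ℕ} (ν : Measure (unitaryGroup (Fin n) 𝕜))
  [ν.IsMulLeftInvariant]

theorem exists_unitary_perm (σ : Equiv.Perm (Fin n)) :
    ∃ W : unitaryGroup (Fin n) 𝕜, ∀ v : Fin n → 𝕜, W.1 *ᵥ v = v ∘ σ := by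
  refine ⟨⟨σ.permMatrix 𝕜, ?_⟩, fun v => permMatrix_mulVec σ⟩
  rw [mem_unitaryGroup_iff, star_eq_conjTranspose, conjTranspose_permMatrix, ← permMatrix_mul]
  simp

theorem integral_comp_perm (u : Fin n → 𝕜) (σ : Equiv.Perm (Fin n)) (f : (Fin n → 𝕜) → ℝ) :
    ∫ V, f ((V.1 *ᵥ u) ∘ σ) ∂ν = ∫ V, f (V.1 *ᵥ u) ∂ν := by
  obtain ⟨W, hW⟩ := exists_unitary_perm (𝕜 := 𝕜) σ
  rw [← integral_mul_left_eq_self (fun V => f (V.1 *ᵥ u)) W]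
  simp_rw [UnitaryGroup.mul_val, ← mulVec_mulVec, hW]

variable [IsProbabilityMeasure ν]

/-- Stein's method. Swapping coordinates `i` and `j` preserves the law, changes `S = ∑ aᵢ |vᵢ|²` to
`S - dᵢⱼ`, and flips the sign of `dᵢⱼ = (aᵢ - aⱼ)(|vᵢ|² - |vⱼ|²)`. Since `∑ aᵢ = 0` gives `∑ dᵢⱼ =
2nS`, the moment `E S⁴` is an average of the `E dᵢⱼ S³`, and antisymmetry replaces each by a term of
order `dᵢⱼ² S²`. With `∑ dᵢⱼ² ≤ 2n A² Y` and `Y = ∑ |vᵢ|⁴`, this bounds `E S⁴` by a multiple of `A⁴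
E Y²`, hence by eighth moments. -/
theorem integral_weighted_pow_four_le (u : Fin n → 𝕜) (a : Fin n → ℝ) (ha : ∑ i, a i = 0) {A : ℝ}
    (hA : ∀ i j, |a i - a j| ≤ A) :
    ∫ V, (∑ i, a i * ‖(V.1 *ᵥ u) i‖ ^ 2) ^ 4 ∂ν ≤
      9 / 4 * A ^ 4 * (1290240 * (∑ i, ‖u i‖ ^ 2) ^ 4 / (n : ℝ) ^ 2) := by
  rcases Nat.eq_zero_or_pos n with rfl | hn'
  · simp
  have hn : (0 : ℝ) < n := by exact_mod_cast hn'
  set S : (Fin n → 𝕜) → ℝ := fun v => ∑ i, a i * ‖v i‖ ^ 2 with hS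
  set Y : (Fin n → 𝕜) → ℝ := fun v => ∑ i, (‖v i‖ ^ 2) ^ 2 with hY
  set d : Fin n → Fin n → (Fin n → 𝕜) → ℝ :=
    fun i j v => (a i - a j) * (‖v i‖ ^ 2 - ‖v j‖ ^ 2) with hd
  have cv : Continuous fun V : unitaryGroup (Fin n) 𝕜 => V.1 *ᵥ u :=
    continuous_subtype_val.matrix_mulVec continuous_const
  have cS : Continuous S := by fun_prop
  have cY : Continuous Y := by fun_prop
  have cd : ∀ i j, Continuous (d i j) := fun i j => by fun_prop
  have int : ∀ f : (Fin n → 𝕜) → ℝ, Continuous f → Integrable (fun V => f (V.1 *ᵥ u)) ν :=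
    fun f hf => integrable_of_continuous ν (hf.comp cv)
  have hswap : ∀ i j v, S (v ∘ Equiv.swap i j) = S v - d i j v := by
    intro i j v
    rcases eq_or_ne i j with rfl | hij
    · simp [hd]
    simp only [hS, hd, Function.comp]
    have h1 : ∀ g : Fin n → ℝ, ∑ k, g k = g i + (g j + ∑ k ∈ (Finset.univ.erase i).erase j, g k) :=
      fun g => by
        rw [Finset.add_sum_erase _ _ (by simp [hij.symm]), Finset.add_sum_erase _ _ (by simp)]
    rw [h1, h1 (fun k => a k * ‖v k‖ ^ 2), Equiv.swap_apply_left, Equiv.swap_apply_right]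
    have h2 : ∑ k ∈ (Finset.univ.erase i).erase j, a k * ‖v (Equiv.swap i j k)‖ ^ 2 =
        ∑ k ∈ (Finset.univ.erase i).erase j, a k * ‖v k‖ ^ 2 := by
      refine Finset.sum_congr rfl fun k hk => ?_
      simp only [Finset.mem_erase] at hk
      rw [Equiv.swap_apply_of_ne_of_ne hk.2.1 hk.1]
    rw [h2]
    ring
  have hdswap : ∀ i j v, d i j (v ∘ Equiv.swap i j) = - d i j v := by
    intro i j v
    simp only [hd, Function.comp, Equiv.swap_apply_left, Equiv.swap_apply_right]
    ring
  have hdS : ∀ i j, ∫ V, d i j (V.1 *ᵥ u) * S (V.1 *ᵥ u) ^ 3 ∂ν ≤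
      3 / 2 * ∫ V, d i j (V.1 *ᵥ u) ^ 2 * S (V.1 *ᵥ u) ^ 2 ∂ν := by
    intro i j
    have h1 := integral_comp_perm ν u (Equiv.swap i j) (fun v => d i j v * S v ^ 3)
    have h2 := integral_comp_perm ν u (Equiv.swap i j) (fun v => d i j v ^ 2 * S v ^ 2)
    simp only [hswap, hdswap, neg_sq] at h1 h2
    have i1 := int (fun v => d i j v * S v ^ 3) ((cd i j).mul (cS.pow 3))
    have i2 := int (fun v => -d i j v * (S v - d i j v) ^ 3)
      ((cd i j).neg.mul ((cS.sub (cd i j)).pow 3))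
    have i3 := int (fun v => d i j v ^ 2 * S v ^ 2) (((cd i j).pow 2).mul (cS.pow 2))
    have i4 := int (fun v => d i j v ^ 2 * (S v - d i j v) ^ 2)
      (((cd i j).pow 2).mul ((cS.sub (cd i j)).pow 2))
    -- Pointwise, with `t = s - D`: `D (s³ - t³) = D² (s² + s t + t²) ≤ (3/2) D² (s² + t²)`. After
    -- the swap both halves on each side have equal integrals.
    have h3 := integral_mono (i1.add i2) ((i3.add i4).const_mul (3 / 2)) (fun V => by
      simp only [Pi.add_apply]
      set D := d i j (V.1 *ᵥ u)
      set s := S (V.1 *ᵥ u)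
      have : 0 ≤ D ^ 2 * (s - (s - D)) ^ 2 := by positivity
      nlinarith)
    simp only [Pi.add_apply] at h3
    rw [integral_add i1 i2, integral_const_mul, integral_add i3 i4, h1, h2] at h3
    linarith
  have hsum : ∀ v, ∑ i, ∑ j, d i j v = 2 * n * S v := by
    intro v
    have h1 : ∀ i j, d i j v = a i * ‖v i‖ ^ 2 - a i * ‖v j‖ ^ 2 - a j * ‖v i‖ ^ 2
        + a j * ‖v j‖ ^ 2 := fun i j => by simp only [hd]; ring
    simp_rw [h1, Finset.sum_add_distrib, Finset.sum_sub_distrib, ← Finset.mul_sum,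
      ← Finset.sum_mul, Finset.sum_const, Finset.card_fin, nsmul_eq_mul]
    have h2 : ∑ i, a i * ((n : ℝ) * ‖v i‖ ^ 2) = n * S v := by
      rw [hS, Finset.mul_sum]
      exact Finset.sum_congr rfl fun i _ => by ring
    rw [h2, ha]
    simp only [hS, zero_mul, Finset.sum_const_zero]
    ring
  have hsq : ∀ v, ∑ i, ∑ j, d i j v ^ 2 ≤ A ^ 2 * (2 * n * Y v) := by
    intro v
    have h1 : ∀ i j, d i j v ^ 2 ≤ A ^ 2 * ((‖v i‖ ^ 2) ^ 2 + (‖v j‖ ^ 2) ^ 2) := by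
      intro i j
      simp only [hd]
      rw [mul_pow]
      refine mul_le_mul ?_ ?_ (sq_nonneg _) (sq_nonneg _)
      · exact sq_le_sq' (by linarith [neg_le_of_abs_le (hA i j)]) (le_of_abs_le (hA i j))
      · have : 0 ≤ ‖v i‖ ^ 2 * ‖v j‖ ^ 2 := by positivity
        nlinarith
    calc _ ≤ ∑ i, ∑ j, A ^ 2 * ((‖v i‖ ^ 2) ^ 2 + (‖v j‖ ^ 2) ^ 2) :=
          Finset.sum_le_sum fun i _ => Finset.sum_le_sum fun j _ => h1 i j
      _ = _ := by
        simp_rw [← Finset.mul_sum, Finset.sum_add_distrib, Finset.sum_const, Finset.card_fin,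
          nsmul_eq_mul, ← Finset.mul_sum]
        simp only [hY]
        ring
  have iS4 := int (fun v => S v ^ 4) (cS.pow 4)
  have iY2 := int (fun v => Y v ^ 2) (cY.pow 2)
  have iSY := int (fun v => S v ^ 2 * Y v) ((cS.pow 2).mul cY)
  have h1 : 2 * n * ∫ V, S (V.1 *ᵥ u) ^ 4 ∂ν ≤ 3 / 2 * (A ^ 2 * (2 * n *
      ∫ V, S (V.1 *ᵥ u) ^ 2 * Y (V.1 *ᵥ u) ∂ν)) := by
    calc 2 * n * ∫ V, S (V.1 *ᵥ u) ^ 4 ∂ν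
        = ∫ V, ∑ i, ∑ j, d i j (V.1 *ᵥ u) * S (V.1 *ᵥ u) ^ 3 ∂ν := by
          rw [← integral_const_mul]
          congr 1 with V
          simp_rw [← Finset.sum_mul]
          rw [hsum]
          ring
      _ = ∑ i, ∑ j, ∫ V, d i j (V.1 *ᵥ u) * S (V.1 *ᵥ u) ^ 3 ∂ν := by
          rw [integral_finsetSum _ fun i _ => integrable_finsetSum _ fun j _ =>
            int (fun v => d i j v * S v ^ 3) ((cd i j).mul (cS.pow 3))]
          refine Finset.sum_congr rfl fun i _ => ?_
          rw [integral_finsetSum _ fun j _ =>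
            int (fun v => d i j v * S v ^ 3) ((cd i j).mul (cS.pow 3))]
      _ ≤ ∑ i, ∑ j, 3 / 2 * ∫ V, d i j (V.1 *ᵥ u) ^ 2 * S (V.1 *ᵥ u) ^ 2 ∂ν :=
          Finset.sum_le_sum fun i _ => Finset.sum_le_sum fun j _ => hdS i j
      _ = 3 / 2 * ∫ V, ∑ i, ∑ j, d i j (V.1 *ᵥ u) ^ 2 * S (V.1 *ᵥ u) ^ 2 ∂ν := by
          rw [integral_finsetSum _ fun i _ => integrable_finsetSum _ fun j _ =>
            int (fun v => d i j v ^ 2 * S v ^ 2) (((cd i j).pow 2).mul (cS.pow 2)),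
            Finset.mul_sum]
          refine Finset.sum_congr rfl fun i _ => ?_
          rw [integral_finsetSum _ fun j _ =>
            int (fun v => d i j v ^ 2 * S v ^ 2) (((cd i j).pow 2).mul (cS.pow 2)),
            Finset.mul_sum]
      _ ≤ 3 / 2 * ∫ V, A ^ 2 * (2 * n * (S (V.1 *ᵥ u) ^ 2 * Y (V.1 *ᵥ u))) ∂ν := by
          refine mul_le_mul_of_nonneg_left (integral_mono (integrable_finsetSum _ fun i _ =>
            integrable_finsetSum _ fun j _ => int (fun v => d i j v ^ 2 * S v ^ 2)
              (((cd i j).pow 2).mul (cS.pow 2))) ((iSY.const_mul _).const_mul _) fun V => ?_)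
            (by norm_num)
          simp only
          simp_rw [← Finset.sum_mul]
          have := mul_le_mul_of_nonneg_right (hsq (V.1 *ᵥ u)) (sq_nonneg (S (V.1 *ᵥ u)))
          linarith
      _ = _ := by rw [integral_const_mul, integral_const_mul]
  have h2 : ∫ V, S (V.1 *ᵥ u) ^ 4 ∂ν ≤ 3 / 2 * (A ^ 2 *
      ∫ V, S (V.1 *ᵥ u) ^ 2 * Y (V.1 *ᵥ u) ∂ν) := by
    have : 0 < 2 * (n : ℝ) := by positivity
    refine le_of_mul_le_mul_left ?_ this
    linarith
  -- Young's inequality, weighted so that half of `E S⁴` can be absorbed on the left; this leaves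
  -- the factor `9 / 4`.
  have h3 : 3 / 2 * (A ^ 2 * ∫ V, S (V.1 *ᵥ u) ^ 2 * Y (V.1 *ᵥ u) ∂ν) ≤
      1 / 2 * ∫ V, S (V.1 *ᵥ u) ^ 4 ∂ν + 9 / 8 * A ^ 4 * ∫ V, Y (V.1 *ᵥ u) ^ 2 ∂ν := by
    rw [← integral_const_mul, ← integral_const_mul, ← integral_const_mul, ← integral_const_mul,
      ← integral_add (iS4.const_mul _) (iY2.const_mul _)]
    refine integral_mono ((iSY.const_mul _).const_mul _)
      ((iS4.const_mul _).add (iY2.const_mul _)) fun V => ?_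
    simp only
    nlinarith [sq_nonneg (S (V.1 *ᵥ u) ^ 2 - 3 / 2 * A ^ 2 * Y (V.1 *ᵥ u))]
  have h4 : ∫ V, Y (V.1 *ᵥ u) ^ 2 ∂ν ≤ 1290240 * (∑ i, ‖u i‖ ^ 2) ^ 4 / (n : ℝ) ^ 2 := by
    have i8 : ∀ i, Integrable (fun V => ‖(V.1 *ᵥ u) i‖ ^ 8) ν := fun i =>
      int (fun v => ‖v i‖ ^ 8) (by fun_prop)
    calc ∫ V, Y (V.1 *ᵥ u) ^ 2 ∂ν ≤ ∫ V, n * ∑ i, ‖(V.1 *ᵥ u) i‖ ^ 8 ∂ν := by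
          refine integral_mono iY2 ((integrable_finsetSum _ fun i _ => i8 i).const_mul _)
            fun V => ?_
          have := sq_sum_le_card_mul_sum_sq (s := Finset.univ)
            (f := fun i => (‖(V.1 *ᵥ u) i‖ ^ 2) ^ 2)
          simpa [hY, ← pow_mul] using this
      _ = n * ∑ i, ∫ V, ‖(V.1 *ᵥ u) i‖ ^ 8 ∂ν := by
          rw [integral_const_mul, integral_finsetSum _ fun i _ => i8 i]
      _ ≤ n * ∑ _i : Fin n, 1290240 * (∑ i, ‖u i‖ ^ 2) ^ 4 / (n : ℝ) ^ 4 :=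
          mul_le_mul_of_nonneg_left (Finset.sum_le_sum fun i _ =>
            integral_norm_entry_pow_eight_le ν u i) hn.le
      _ = _ := by
          rw [Finset.sum_const, Finset.card_fin, nsmul_eq_mul]
          field_simp
  have h5 := mul_le_mul_of_nonneg_left h4 (show 0 ≤ 9 / 4 * A ^ 4 by positivity)
  linarith

theorem norm_pow_four_le (x : 𝕜) :
    ‖x‖ ^ 4 ≤ 2 * (RCLike.re x ^ 4 + RCLike.im x ^ 4) := by
  have h : ‖x‖ ^ 4 = (RCLike.re x ^ 2 + RCLike.im x ^ 2) ^ 2 := by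
    rw [show 4 = 2 * 2 from rfl, pow_mul, RCLike.norm_sq_eq_def]
    ring
  rw [h]
  nlinarith [sq_nonneg (RCLike.re x ^ 2 - RCLike.im x ^ 2)]

theorem re_conj_mul_eq (x y : 𝕜) :
    RCLike.re (conj x * y) = (‖x + y‖ ^ 2 - ‖x - y‖ ^ 2) / 4 := by
  rw [RCLike.norm_sq_eq_def, RCLike.norm_sq_eq_def]
  simp only [RCLike.mul_re, map_add, map_sub, RCLike.conj_re, RCLike.conj_im]
  ring

theorem im_conj_mul_eq (x y : 𝕜) :
    RCLike.im (conj x * y) = (‖x - RCLike.I * y‖ ^ 2 - ‖x + RCLike.I * y‖ ^ 2) / 4 := by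
  have h := re_conj_mul_eq x (- (RCLike.I * y))
  rw [← sub_eq_add_neg, sub_neg_eq_add] at h
  rw [← h]
  -- Over `ℝ` the element `RCLike.I` is zero and both sides vanish.
  rcases RCLike.I_eq_zero_or_im_I_eq_one (K := 𝕜) with h0 | h0
  · have : ∀ w : 𝕜, RCLike.im w = 0 := fun w => RCLike.im_eq_zero h0 w
    simp [h0, this]
  · simp only [RCLike.mul_re, RCLike.mul_im, map_neg, RCLike.conj_re, RCLike.conj_im,
      RCLike.I_re, h0]
    ring

/-- Polarization reduces to the quadratic sums at `u + c u'` with `c = ±1, ±I`, whose squared norms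
are at most `4`. The constants are `576 = (9/4) · 4⁴` for each sum and `144 = 4 · 576 / 16` for the
four together. -/
theorem integral_weighted_inner_pow_four_le (u u' : Fin n → 𝕜) (hu : ∑ i, ‖u i‖ ^ 2 = 1)
    (hu' : ∑ i, ‖u' i‖ ^ 2 = 1) (a : Fin n → ℝ) (ha : ∑ i, a i = 0) {A : ℝ}
    (hA : ∀ i j, |a i - a j| ≤ A) :
    ∫ V, ‖∑ i, (a i : 𝕜) * (conj ((V.1 *ᵥ u) i) * (V.1 *ᵥ u') i)‖ ^ 4 ∂ν ≤
      144 * A ^ 4 * (1290240 / (n : ℝ) ^ 2) := by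
  set S : (Fin n → 𝕜) → unitaryGroup (Fin n) 𝕜 → ℝ :=
    fun v V => ∑ i, a i * ‖(V.1 *ᵥ v) i‖ ^ 2 with hS
  have cS : ∀ v, Continuous (S v) := fun v => continuous_finsetSum _ fun i _ =>
    continuous_const.mul ((continuous_mulVec_apply v i).norm.pow 2)
  have bS : ∀ v, ∑ i, ‖v i‖ ^ 2 ≤ 4 → ∫ V, S v V ^ 4 ∂ν ≤
      576 * A ^ 4 * (1290240 / (n : ℝ) ^ 2) := by
    intro v hv
    refine (integral_weighted_pow_four_le ν v a ha hA).trans ?_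
    have h0 : 0 ≤ ∑ i, ‖v i‖ ^ 2 := Finset.sum_nonneg fun i _ => by positivity
    have h1 : (∑ i, ‖v i‖ ^ 2) ^ 4 ≤ 4 ^ 4 := pow_le_pow_left₀ h0 hv 4
    have h2 : 0 ≤ 9 / 4 * A ^ 4 * (1290240 / (n : ℝ) ^ 2) := by positivity
    have h3 := mul_le_mul_of_nonneg_left h1 h2
    calc _ = 9 / 4 * A ^ 4 * (1290240 / (n : ℝ) ^ 2) * (∑ i, ‖v i‖ ^ 2) ^ 4 := by ring
      _ ≤ _ := h3
      _ = _ := by ring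
  have bnd : ∀ c : 𝕜, ‖c‖ ≤ 1 → ∑ i, ‖(u + c • u') i‖ ^ 2 ≤ 4 := by
    intro c hc
    have : ∀ i, ‖(u + c • u') i‖ ^ 2 ≤ 2 * ‖u i‖ ^ 2 + 2 * ‖u' i‖ ^ 2 := by
      intro i
      have h1 : ‖(u + c • u') i‖ ≤ ‖u i‖ + ‖u' i‖ := by
        refine (norm_add_le _ _).trans ?_
        simp only [Pi.smul_apply, smul_eq_mul, norm_mul]
        have := mul_le_mul_of_nonneg_right hc (norm_nonneg (u' i))
        linarith
      have h2 := pow_le_pow_left₀ (norm_nonneg _) h1 2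
      nlinarith [sq_nonneg (‖u i‖ - ‖u' i‖)]
    calc _ ≤ ∑ i, (2 * ‖u i‖ ^ 2 + 2 * ‖u' i‖ ^ 2) := Finset.sum_le_sum fun i _ => this i
      _ = 4 := by
        rw [Finset.sum_add_distrib, ← Finset.mul_sum, ← Finset.mul_sum, hu, hu']
        norm_num
  have hI : ‖(RCLike.I : 𝕜)‖ ≤ 1 := by
    by_cases h0 : (RCLike.I : 𝕜) = 0
    · simp [h0]
    · rw [RCLike.norm_I_of_ne_zero h0]
  have lin : ∀ (c : 𝕜) (V : unitaryGroup (Fin n) 𝕜) i,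
      (V.1 *ᵥ (u + c • u')) i = (V.1 *ᵥ u) i + c * (V.1 *ᵥ u') i := by
    intro c V i
    rw [mulVec_add, mulVec_smul]
    rfl
  have hre : ∀ V : unitaryGroup (Fin n) 𝕜,
      RCLike.re (∑ i, (a i : 𝕜) * (conj ((V.1 *ᵥ u) i) * (V.1 *ᵥ u') i)) =
      (S (u + (1 : 𝕜) • u') V - S (u + (-1 : 𝕜) • u') V) / 4 := by
    intro V
    simp only [hS, map_sum, RCLike.re_ofReal_mul, re_conj_mul_eq, lin]
    rw [← Finset.sum_sub_distrib, Finset.sum_div]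
    refine Finset.sum_congr rfl fun i _ => ?_
    rw [one_mul, neg_one_mul, ← sub_eq_add_neg]
    ring
  have him : ∀ V : unitaryGroup (Fin n) 𝕜,
      RCLike.im (∑ i, (a i : 𝕜) * (conj ((V.1 *ᵥ u) i) * (V.1 *ᵥ u') i)) =
      (S (u + (-RCLike.I : 𝕜) • u') V - S (u + (RCLike.I : 𝕜) • u') V) / 4 := by
    intro V
    simp only [hS, map_sum, RCLike.im_ofReal_mul, im_conj_mul_eq, lin]
    rw [← Finset.sum_sub_distrib, Finset.sum_div]
    refine Finset.sum_congr rfl fun i _ => ?_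
    rw [neg_mul, ← sub_eq_add_neg]
    ring
  have hpt : ∀ V : unitaryGroup (Fin n) 𝕜,
      ‖∑ i, (a i : 𝕜) * (conj ((V.1 *ᵥ u) i) * (V.1 *ᵥ u') i)‖ ^ 4 ≤
      1 / 16 * ((S (u + (1 : 𝕜) • u') V ^ 4 + S (u + (-1 : 𝕜) • u') V ^ 4) +
        (S (u + (-RCLike.I : 𝕜) • u') V ^ 4 + S (u + (RCLike.I : 𝕜) • u') V ^ 4)) := by
    intro V
    have h1 := norm_pow_four_le (∑ i, (a i : 𝕜) * (conj ((V.1 *ᵥ u) i) * (V.1 *ᵥ u') i))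
    rw [hre, him] at h1
    have h2 : ∀ p q : ℝ, ((p - q) / 4) ^ 4 ≤ 1 / 32 * (p ^ 4 + q ^ 4) := fun p q => by
      have h3 : (p - q) ^ 2 ≤ 2 * (p ^ 2 + q ^ 2) := by nlinarith [sq_nonneg (p + q)]
      have h4 := pow_le_pow_left₀ (sq_nonneg _) h3 2
      nlinarith [sq_nonneg (p ^ 2 - q ^ 2)]
    have h5 := h2 (S (u + (1 : 𝕜) • u') V) (S (u + (-1 : 𝕜) • u') V)
    have h6 := h2 (S (u + (-RCLike.I : 𝕜) • u') V) (S (u + (RCLike.I : 𝕜) • u') V)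
    linarith
  have i4 : ∀ v, Integrable (fun V => S v V ^ 4) ν := fun v =>
    integrable_of_continuous ν ((cS v).pow 4)
  have il : Integrable (fun V : unitaryGroup (Fin n) 𝕜 =>
      ‖∑ i, (a i : 𝕜) * (conj ((V.1 *ᵥ u) i) * (V.1 *ᵥ u') i)‖ ^ 4) ν :=
    integrable_of_continuous ν ((continuous_finsetSum _ fun i _ => continuous_const.mul
      ((RCLike.continuous_conj.comp (continuous_mulVec_apply u i)).mul
        (continuous_mulVec_apply u' i))).norm.pow 4)
  have h := integral_mono il (((((i4 _).add (i4 _)).add ((i4 _).add (i4 _)))).const_mul _) hpt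
  rw [integral_const_mul, integral_add' ((i4 _).add (i4 _)) ((i4 _).add (i4 _)),
    integral_add' (i4 _) (i4 _), integral_add' (i4 _) (i4 _)] at h
  have b1 := bS _ (bnd 1 (by simp))
  have b2 := bS _ (bnd (-1) (by simp))
  have b3 := bS _ (bnd (-RCLike.I) (by simpa using hI))
  have b4 := bS _ (bnd RCLike.I hI)
  linarith

end ExchangeablePairs

end SpikedModel

namespace SpikedModel

open Matrix ComplexConjugate

/-! ### The resolvent, its centering, and the scalar statistic for its compression. -/

section Resolvent

variable {𝕜 : Type*} [RCLike 𝕜] {n : ℕ}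

theorem exists_unitary_diagonalization {A : Matrix (Fin n) (Fin n) 𝕜} (hA : A.IsHermitian) :
    ∃ W : unitaryGroup (Fin n) 𝕜,
      A = W.1 * diagonal (fun i : Fin n => (lam hA (i + 1) : 𝕜)) * star W.1 := by
  obtain ⟨e, he⟩ := exists_sorted_eigenbasis hA
  refine ⟨⟨(EuclideanSpace.basisFun (Fin n) 𝕜).toBasis.toMatrix e.toBasis,
    (EuclideanSpace.basisFun (Fin n) 𝕜).toMatrix_orthonormalBasis_mem_unitary e⟩, ?_⟩
  set W := (EuclideanSpace.basisFun (Fin n) 𝕜).toBasis.toMatrix e.toBasis with hW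
  have hWapp : ∀ k i, W k i = e i k := fun k i => by
    simp [hW, Module.Basis.toMatrix_apply]
  have hWu : W * star W = 1 := ((EuclideanSpace.basisFun (Fin n) 𝕜).toMatrix_orthonormalBasis_mem_unitary e).2
  have h1 : A * W = W * diagonal (fun i : Fin n => (lam hA (i + 1) : 𝕜)) := by
    ext k i
    have h2 := congrArg (fun v : EuclideanSpace 𝕜 (Fin n) => v k) (he i)
    simp only [Matrix.toLpLin_apply, PiLp.smul_apply, smul_eq_mul] at h2
    rw [mul_diagonal, hWapp, mul_comm, ← h2, Matrix.mul_apply]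
    simp only [hWapp]
    rfl
  simp only
  rw [← h1, mul_assoc, hWu, mul_one]

/-- The resolvent `(z - x)⁻¹`. -/
noncomputable def resolv (z : ℝ) (x : Matrix (Fin n) (Fin n) 𝕜) : Matrix (Fin n) (Fin n) 𝕜 :=
  ((z : 𝕜) • (1 : Matrix (Fin n) (Fin n) 𝕜) - x)⁻¹

/-- The resolvent, minus its normalized trace. -/
noncomputable def centeredResolv (z : ℝ) (x : Matrix (Fin n) (Fin n) 𝕜) :
    Matrix (Fin n) (Fin n) 𝕜 :=
  resolv z x - ((resolv z x).trace / n) • 1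

theorem unitary_conj_diagonal_mul (W : unitaryGroup (Fin n) 𝕜) (M N : Matrix (Fin n) (Fin n) 𝕜) :
    W.1 * M * star W.1 * (W.1 * N * star W.1) = W.1 * (M * N) * star W.1 := by
  have h := UnitaryGroup.star_mul_self W
  calc _ = W.1 * M * (star W.1 * W.1) * N * star W.1 := by simp only [mul_assoc]
    _ = _ := by rw [h, mul_one]; simp only [mul_assoc]

theorem unitary_conj_smul_one (W : unitaryGroup (Fin n) 𝕜) (c : 𝕜) :
    W.1 * (c • 1) * star W.1 = c • 1 := by
  rw [mul_smul_comm, mul_one, smul_mul_assoc, W.2.2]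

theorem trace_unitary_conj (W : unitaryGroup (Fin n) 𝕜) (M : Matrix (Fin n) (Fin n) 𝕜) :
    (W.1 * M * star W.1).trace = M.trace := by
  rw [trace_mul_comm, ← mul_assoc, UnitaryGroup.star_mul_self, one_mul]

theorem resolv_spectral {x : Matrix (Fin n) (Fin n) 𝕜} (W : unitaryGroup (Fin n) 𝕜)
    (d : Fin n → ℝ) (hx : x = W.1 * diagonal (fun i => (d i : 𝕜)) * star W.1) {z : ℝ}
    (hz : ∀ i, d i < z) :
    resolv z x = W.1 * diagonal (fun i => ((1 / (z - d i) : ℝ) : 𝕜)) * star W.1 ∧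
      ((z : 𝕜) • (1 : Matrix (Fin n) (Fin n) 𝕜) - x) * resolv z x = 1 := by
  have h1 : (z : 𝕜) • (1 : Matrix (Fin n) (Fin n) 𝕜) - x =
      W.1 * diagonal (fun i => ((z - d i : ℝ) : 𝕜)) * star W.1 := by
    rw [hx, ← unitary_conj_smul_one W, ← sub_mul, ← mul_sub, smul_one_eq_diagonal, diagonal_sub]
    push_cast
    rfl
  have h2 : ((z : 𝕜) • (1 : Matrix (Fin n) (Fin n) 𝕜) - x) *
      (W.1 * diagonal (fun i => ((1 / (z - d i) : ℝ) : 𝕜)) * star W.1) = 1 := by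
    rw [h1, unitary_conj_diagonal_mul, diagonal_mul_diagonal]
    have : (fun i => ((z - d i : ℝ) : 𝕜) * ((1 / (z - d i) : ℝ) : 𝕜)) = fun _ => 1 := by
      ext i
      rw [← RCLike.ofReal_mul, mul_one_div_cancel (sub_ne_zero.mpr (hz i).ne'), RCLike.ofReal_one]
    rw [this, diagonal_one, mul_one, W.2.2]
  have h3 : resolv z x = W.1 * diagonal (fun i => ((1 / (z - d i) : ℝ) : 𝕜)) * star W.1 :=
    inv_eq_right_inv h2
  exact ⟨h3, by rw [h3, h2]⟩

theorem isHermitian_conj_diagonal (W : unitaryGroup (Fin n) 𝕜) (d : Fin n → ℝ) :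
    (W.1 * diagonal (fun i => (d i : 𝕜)) * star W.1).IsHermitian := by
  rw [star_eq_conjTranspose]
  refine isHermitian_mul_mul_conjTranspose _ ?_
  simp [IsHermitian, diagonal_conjTranspose, Pi.star_def]

theorem trace_resolv {x : Matrix (Fin n) (Fin n) 𝕜} (W : unitaryGroup (Fin n) 𝕜)
    (d : Fin n → ℝ) (hx : x = W.1 * diagonal (fun i => (d i : 𝕜)) * star W.1) {z : ℝ}
    (hz : ∀ i, d i < z) : (resolv z x).trace = ((∑ i, 1 / (z - d i) : ℝ) : 𝕜) := by
  rw [(resolv_spectral W d hx hz).1, trace_unitary_conj, trace_diagonal]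
  push_cast
  rfl

theorem centeredResolv_spectral {x : Matrix (Fin n) (Fin n) 𝕜} (W : unitaryGroup (Fin n) 𝕜)
    (d : Fin n → ℝ) (hx : x = W.1 * diagonal (fun i => (d i : 𝕜)) * star W.1) {z : ℝ}
    (hz : ∀ i, d i < z) :
    centeredResolv z x = W.1 *
      diagonal (fun i => ((1 / (z - d i) - (∑ i, 1 / (z - d i)) / n : ℝ) : 𝕜)) * star W.1 := by
  rw [centeredResolv, trace_resolv W d hx hz, (resolv_spectral W d hx hz).1,
    ← unitary_conj_smul_one W, ← sub_mul, ← mul_sub, smul_one_eq_diagonal, diagonal_sub]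
  push_cast
  rfl

theorem inner_toEuclideanLin (A : Matrix (Fin n) (Fin n) 𝕜) (v w : EuclideanSpace 𝕜 (Fin n)) :
    inner 𝕜 v (A.toEuclideanLin w) = star v.ofLp ⬝ᵥ (A *ᵥ w.ofLp) := by
  rw [EuclideanSpace.inner_eq_star_dotProduct, dotProduct_comm]
  rfl

/-- The statistic that measures how far the resolvent of `x` is from a multiple of the identity
on the range of `p`. -/
noncomputable def spikeStat (z : ℝ) (x p : Matrix (Fin n) (Fin n) 𝕜) : ℝ :=
  RCLike.re (p * p * centeredResolv z x * (p * p) * centeredResolv z x).trace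

theorem HasSpikes.matrix_mul_self {r : ℕ} {p : Matrix (Fin n) (Fin n) 𝕜} {θ : Fin r → ℝ}
    {u : Fin r → EuclideanSpace 𝕜 (Fin n)} (h : HasSpikes p θ u) :
    p * p = ∑ j, ((θ j ^ 2 : ℝ) : 𝕜) • vecMulVec (u j).ofLp (star (u j).ofLp) := by
  have h1 : p = ∑ j, (θ j : 𝕜) • vecMulVec (u j).ofLp (star (u j).ofLp) := by
    refine Matrix.toEuclideanLin.injective (LinearMap.ext fun w => ?_)
    rw [h.2, map_sum, LinearMap.sum_apply]
    refine Finset.sum_congr rfl fun j _ => ?_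
    rw [map_smul, LinearMap.smul_apply, mul_smul]
    congr 1
    rw [toLpLin_apply, vecMulVec_mulVec, EuclideanSpace.inner_eq_star_dotProduct, dotProduct_comm]
    ext k
    simp [mul_comm]
  have h2 : ∀ j, p *ᵥ (u j).ofLp = (θ j : 𝕜) • (u j).ofLp := by
    intro j
    have h3 := h.2 (u j)
    rw [Finset.sum_eq_single j] at h3
    · rw [inner_self_eq_norm_sq_to_K, h.1.1 j] at h3
      have := congrArg WithLp.ofLp h3
      simpa using this
    · intro k _ hk
      rw [h.1.2 hk]
      simp
    · simp
  conv_lhs =>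
    rhs
    rw [h1]
  rw [Finset.mul_sum]
  refine Finset.sum_congr rfl fun j _ => ?_
  rw [mul_smul_comm, mul_vecMulVec, h2, smul_vecMulVec, smul_smul]
  congr 1
  push_cast
  ring

theorem trace_vecMulVec_mul (a b c d : Fin n → 𝕜) (g : Matrix (Fin n) (Fin n) 𝕜) :
    (vecMulVec a b * g * vecMulVec c d * g).trace = (b ⬝ᵥ (g *ᵥ c)) * (d ⬝ᵥ (g *ᵥ a)) := by
  rw [vecMulVec_mul, vecMulVec_mul_vecMulVec, vecMulVec_mul, trace_vecMulVec, smul_vecMul,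
    dotProduct_smul, dotProduct_mulVec, dotProduct_mulVec, smul_eq_mul, dotProduct_comm a]

/-- The reason for using `p * p`: the weights are nonnegative whatever the signs of the spikes, so a
small value forces every entry between nonzero spikes to be small. The definition itself does not
mention the eigenvectors. -/
theorem spikeStat_eq {r : ℕ} {x p : Matrix (Fin n) (Fin n) 𝕜} {θ : Fin r → ℝ}
    {u : Fin r → EuclideanSpace 𝕜 (Fin n)} (h : HasSpikes p θ u) {z : ℝ}
    (hg : (centeredResolv z x).IsHermitian) :
    spikeStat z x p = ∑ j, ∑ k, θ j ^ 2 * θ k ^ 2 *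
      ‖inner 𝕜 (u j) ((centeredResolv z x).toEuclideanLin (u k))‖ ^ 2 := by
  have hs := isSymmetric_toEuclideanLin_iff.mpr hg
  rw [spikeStat, h.matrix_mul_self, Finset.sum_mul, Finset.sum_mul, Finset.sum_mul, trace_sum,
    map_sum]
  refine Finset.sum_congr rfl fun j _ => ?_
  rw [Finset.mul_sum, Finset.sum_mul, trace_sum, map_sum]
  refine Finset.sum_congr rfl fun k _ => ?_
  rw [smul_mul_assoc, mul_smul_comm, smul_mul_assoc, smul_mul_assoc, smul_mul_assoc, trace_smul,
    trace_smul, trace_vecMulVec_mul, ← inner_toEuclideanLin, ← inner_toEuclideanLin,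
    ← hs (u k) (u j), ← inner_conj_symm (toEuclideanLin (centeredResolv z x) (u k)) (u j),
    RCLike.mul_conj, smul_eq_mul, smul_eq_mul]
  have : ((θ k ^ 2 : ℝ) : 𝕜) * (((θ j ^ 2 : ℝ) : 𝕜) *
      (‖inner 𝕜 (u j) ((centeredResolv z x).toEuclideanLin (u k))‖ : 𝕜) ^ 2) =
      ((θ j ^ 2 * θ k ^ 2 *
      ‖inner 𝕜 (u j) ((centeredResolv z x).toEuclideanLin (u k))‖ ^ 2 : ℝ) : 𝕜) := by
    push_cast
    ring
  rw [this, RCLike.ofReal_re]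

theorem inner_unitary (V : unitaryGroup (Fin n) 𝕜) (v w : EuclideanSpace 𝕜 (Fin n)) :
    inner 𝕜 (V.1.toEuclideanLin v) (V.1.toEuclideanLin w) = inner 𝕜 v w := by
  rw [inner_toEuclideanLin, EuclideanSpace.inner_eq_star_dotProduct, toLpLin_apply, star_mulVec,
    dotProduct_mulVec, vecMul_vecMul, ← star_eq_conjTranspose, UnitaryGroup.star_mul_self,
    vecMul_one, dotProduct_comm]

theorem HasSpikes.conj {r : ℕ} {p : Matrix (Fin n) (Fin n) 𝕜} {θ : Fin r → ℝ}
    {u : Fin r → EuclideanSpace 𝕜 (Fin n)} (h : HasSpikes p θ u) (V : unitaryGroup (Fin n) 𝕜) :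
    HasSpikes (V.1 * p * star V.1) θ (fun j => V.1.toEuclideanLin (u j)) := by
  refine ⟨?_, fun w => ?_⟩
  · rw [orthonormal_iff_ite]
    intro i j
    rw [inner_unitary, orthonormal_iff_ite.mp h.1]
  · have h1 : ∀ (A B : Matrix (Fin n) (Fin n) 𝕜) (v : EuclideanSpace 𝕜 (Fin n)),
        (A * B).toEuclideanLin v = A.toEuclideanLin (B.toEuclideanLin v) := fun A B v => by
      simp [toLpLin_apply, mulVec_mulVec]
    have h2 : V.1.toEuclideanLin ((star V.1).toEuclideanLin w) = w := by
      rw [← h1, V.2.2, toLpLin_one]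
      rfl
    rw [h1, h1, h.2, map_sum]
    refine Finset.sum_congr rfl fun j _ => ?_
    rw [map_smul, ← inner_unitary V (u j), h2]

end Resolvent

end SpikedModel

namespace SpikedModel

open Matrix ComplexConjugate

/-! ### Second moment of the statistic, by averaging over Haar measure. -/

section Expectation

variable {𝕜 : Type*} [RCLike 𝕜] {n : ℕ}

theorem inner_conj_diagonal (W : unitaryGroup (Fin n) 𝕜) (a : Fin n → ℝ)
    (v w : EuclideanSpace 𝕜 (Fin n)) :
    inner 𝕜 v ((W.1 * diagonal (fun i => (a i : 𝕜)) * star W.1).toEuclideanLin w) =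
      ∑ i, (a i : 𝕜) * (conj (((W⁻¹).1 *ᵥ v.ofLp) i) * ((W⁻¹).1 *ᵥ w.ofLp) i) := by
  have h1 : star v.ofLp ᵥ* W.1 = star ((W⁻¹).1 *ᵥ v.ofLp) := by
    rw [UnitaryGroup.inv_val, star_mulVec, star_eq_conjTranspose, conjTranspose_conjTranspose]
  rw [inner_toEuclideanLin, ← mulVec_mulVec, ← mulVec_mulVec, dotProduct_mulVec, h1]
  refine Finset.sum_congr rfl fun i _ => ?_
  rw [mulVec_diagonal, UnitaryGroup.inv_val, Pi.star_apply, RCLike.star_def]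
  ring

/-- The constant in the moment bound for `spikeStat`. -/
noncomputable def spikeConst {r : ℕ} (θ : Fin r → ℝ) (δ : ℝ) : ℝ :=
  (r : ℝ) ^ 2 * ∑ j, ∑ k, (θ j ^ 2 * θ k ^ 2) ^ 2 * (144 * (1 / δ) ^ 4 * 1290240)

theorem abs_inv_sub_inv_le {z δ s t : ℝ} (hδ : 0 < δ) (hs : s ≤ z - δ) (ht : t ≤ z - δ) :
    |1 / (z - s) - 1 / (z - t)| ≤ 1 / δ := by
  have h1 : 0 < 1 / (z - s) := by
    apply one_div_pos.mpr
    linarith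
  have h2 : 0 < 1 / (z - t) := by
    apply one_div_pos.mpr
    linarith
  have h3 : 1 / (z - s) ≤ 1 / δ := one_div_le_one_div_of_le hδ (by linarith)
  have h4 : 1 / (z - t) ≤ 1 / δ := one_div_le_one_div_of_le hδ (by linarith)
  rw [abs_le]
  constructor <;> linarith

theorem continuous_spikeStat_conj (z : ℝ) (x p : Matrix (Fin n) (Fin n) 𝕜) :
    Continuous fun V : unitaryGroup (Fin n) 𝕜 => spikeStat z x (V.1 * p * star V.1) := by
  have h : Continuous fun V : unitaryGroup (Fin n) 𝕜 => V.1 * p * star V.1 :=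
    (continuous_subtype_val.mul continuous_const).mul continuous_subtype_val.star
  exact RCLike.continuous_re.comp
    ((((h.mul h).mul continuous_const).mul (h.mul h)).mul continuous_const).matrix_trace

/-- Diagonalizing `x` by `W` turns each entry into a weighted sum in the coordinates of `W⁻¹V u`,
and left invariance removes `W⁻¹`. The weights are centered by construction and oscillate by at most
`1 / δ`. Cauchy–Schwarz over the `r²` pairs of spikes reduces the square to fourth moments. -/
theorem integral_spikeStat_sq_le (ν : Measure (unitaryGroup (Fin n) 𝕜)) [IsProbabilityMeasure ν]
    [ν.IsMulLeftInvariant] {r : ℕ} {x p : Matrix (Fin n) (Fin n) 𝕜} (hx : x.IsHermitian)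
    {θ : Fin r → ℝ} {u : Fin r → EuclideanSpace 𝕜 (Fin n)} (hp : HasSpikes p θ u) {z δ : ℝ}
    (hδ : 0 < δ) (hxz : ∀ i : Fin n, lam hx (i + 1) ≤ z - δ) :
    ∫ V, spikeStat z x (V.1 * p * star V.1) ^ 2 ∂ν ≤ spikeConst θ δ / (n : ℝ) ^ 2 := by
  rcases Nat.eq_zero_or_pos n with rfl | hn'
  · simp [spikeStat]
  have hn : (n : ℝ) ≠ 0 := by
    have : (0 : ℝ) < n := by exact_mod_cast hn'
    exact this.ne'
  obtain ⟨W, hW⟩ := exists_unitary_diagonalization hx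
  have hz : ∀ i : Fin n, lam hx (i + 1) < z := fun i => by linarith [hxz i]
  set a : Fin n → ℝ := fun i => 1 / (z - lam hx (i + 1)) -
    (∑ i : Fin n, 1 / (z - lam hx (i + 1))) / n with ha
  have hg : centeredResolv z x = W.1 * diagonal (fun i => (a i : 𝕜)) * star W.1 :=
    centeredResolv_spectral W (fun i : Fin n => lam hx (i + 1)) hW hz
  have ha0 : ∑ i, a i = 0 := by
    simp only [ha, Finset.sum_sub_distrib, Finset.sum_const, Finset.card_fin, nsmul_eq_mul]
    field_simp
    ring
  have haA : ∀ i j, |a i - a j| ≤ 1 / δ := fun i j => by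
    have := abs_inv_sub_inv_le hδ (hxz i) (hxz j)
    simpa [ha] using this
  have hgH : (centeredResolv z x).IsHermitian := by
    rw [hg]
    exact isHermitian_conj_diagonal W a
  set t : Fin r → Fin r → unitaryGroup (Fin n) 𝕜 → ℝ := fun j k V =>
    ‖∑ i, (a i : 𝕜) * (conj ((V.1 *ᵥ (u j).ofLp) i) * (V.1 *ᵥ (u k).ofLp) i)‖ with ht
  have hstat : ∀ V : unitaryGroup (Fin n) 𝕜, spikeStat z x (V.1 * p * star V.1) =
      ∑ j, ∑ k, θ j ^ 2 * θ k ^ 2 * t j k (W⁻¹ * V) ^ 2 := by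
    intro V
    rw [spikeStat_eq (hp.conj V) hgH]
    refine Finset.sum_congr rfl fun j _ => Finset.sum_congr rfl fun k _ => ?_
    rw [hg, inner_conj_diagonal]
    simp only [ht, UnitaryGroup.mul_val, ← mulVec_mulVec, toLpLin_apply]
  have hct : ∀ j k, Continuous (t j k) := fun j k =>
    (continuous_finsetSum _ fun i _ => continuous_const.mul
      ((RCLike.continuous_conj.comp (continuous_mulVec_apply _ i)).mul
        (continuous_mulVec_apply _ i))).norm
  have hunit : ∀ j, ∑ i, ‖(u j).ofLp i‖ ^ 2 = 1 := fun j => by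
    rw [← EuclideanSpace.norm_sq_eq, hp.1.1 j, one_pow]
  have hpt : ∀ V : unitaryGroup (Fin n) 𝕜, spikeStat z x (V.1 * p * star V.1) ^ 2 ≤
      (r : ℝ) ^ 2 * ∑ j, ∑ k, (θ j ^ 2 * θ k ^ 2) ^ 2 * t j k (W⁻¹ * V) ^ 4 := by
    intro V
    rw [hstat, ← Finset.sum_product', ← Finset.sum_product']
    have := sq_sum_le_card_mul_sum_sq (s := (Finset.univ ×ˢ Finset.univ : Finset (Fin r × Fin r)))
      (f := fun q => θ q.1 ^ 2 * θ q.2 ^ 2 * t q.1 q.2 (W⁻¹ * V) ^ 2)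
    refine this.trans (le_of_eq ?_)
    rw [Finset.card_product, Finset.card_fin]
    push_cast
    rw [sq]
    congr 1
    exact Finset.sum_congr rfl fun q _ => by ring
  have hcW : ∀ j k, Continuous fun V => t j k (W⁻¹ * V) := fun j k =>
    (hct j k).comp (continuous_const.mul continuous_id)
  have hi : ∀ j k, Integrable (fun V => (θ j ^ 2 * θ k ^ 2) ^ 2 * t j k (W⁻¹ * V) ^ 4) ν :=
    fun j k => integrable_of_continuous ν (continuous_const.mul ((hcW j k).pow 4))
  calc ∫ V, spikeStat z x (V.1 * p * star V.1) ^ 2 ∂ν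
      ≤ ∫ V, (r : ℝ) ^ 2 * ∑ j, ∑ k, (θ j ^ 2 * θ k ^ 2) ^ 2 * t j k (W⁻¹ * V) ^ 4 ∂ν :=
        integral_mono (integrable_of_continuous ν ((continuous_spikeStat_conj z x p).pow 2))
          ((integrable_finsetSum _ fun j _ => integrable_finsetSum _ fun k _ =>
            hi j k).const_mul _) hpt
    _ = (r : ℝ) ^ 2 * ∑ j, ∑ k, (θ j ^ 2 * θ k ^ 2) ^ 2 * ∫ V, t j k V ^ 4 ∂ν := by
        rw [integral_const_mul, integral_finsetSum _ fun j _ => integrable_finsetSum _ fun k _ =>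
          hi j k]
        congr 1
        refine Finset.sum_congr rfl fun j _ => ?_
        rw [integral_finsetSum _ fun k _ => hi j k]
        refine Finset.sum_congr rfl fun k _ => ?_
        rw [integral_const_mul, integral_mul_left_eq_self (fun V => t j k V ^ 4) W⁻¹]
    _ ≤ (r : ℝ) ^ 2 * ∑ j, ∑ k, (θ j ^ 2 * θ k ^ 2) ^ 2 *
          (144 * (1 / δ) ^ 4 * (1290240 / (n : ℝ) ^ 2)) := by
        refine mul_le_mul_of_nonneg_left (Finset.sum_le_sum fun j _ => Finset.sum_le_sum
          fun k _ => mul_le_mul_of_nonneg_left ?_ (by positivity)) (by positivity)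
        exact integral_weighted_inner_pow_four_le ν _ _ (hunit j) (hunit k) a ha0 haA
    _ = _ := by
        simp_rw [spikeConst, mul_div_assoc, Finset.sum_div]
        congr 1
        refine Finset.sum_congr rfl fun j _ => Finset.sum_congr rfl fun k _ => ?_
        ring

/-- The matrices whose Hermitian form is at most `c`. -/
def formLe (n : ℕ) (𝕜 : Type*) [RCLike 𝕜] (c : ℝ) : Set (Matrix (Fin n) (Fin n) 𝕜) :=
  {x | ∀ v : EuclideanSpace 𝕜 (Fin n), hform x v ≤ c * ‖v‖ ^ 2}

theorem lam_le_of_mem_formLe {x : Matrix (Fin n) (Fin n) 𝕜} (hx : x.IsHermitian) {c : ℝ}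
    (h : x ∈ formLe n 𝕜 c) (i : Fin n) : lam hx (i + 1) ≤ c :=
  lam_le_of_forall_mem hx (by omega) i.2 ⊤
    (by rw [finrank_top, finrank_euclideanSpace_fin]; omega) fun w _ => h w

theorem mem_formLe_of_lam_one_le {x : Matrix (Fin n) (Fin n) 𝕜} (hx : x.IsHermitian) {c : ℝ}
    (h : lam hx 1 ≤ c) : x ∈ formLe n 𝕜 c := fun v =>
  (hform_le_lam_one hx v).trans (mul_le_mul_of_nonneg_right h (by positivity))

/-- Truncating by the form instead of by `lam` gives an intersection of closed conditions, so
measurability of the eigenvalues is never needed. -/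
theorem measurableSet_formLe (c : ℝ) : MeasurableSet (formLe n 𝕜 c) := by
  refine IsClosed.measurableSet ?_
  rw [formLe, Set.ofPred_forall]
  refine isClosed_iInter fun v => isClosed_le ?_ continuous_const
  simp only [hform, inner_toEuclideanLin]
  exact RCLike.continuous_re.comp
    (continuous_const.dotProduct (continuous_id.matrix_mulVec continuous_const))

theorem measurable_matrix_inv :
    Measurable fun x : Matrix (Fin n) (Fin n) 𝕜 => x⁻¹ := by
  refine measurable_pi_lambda _ fun i => measurable_pi_lambda _ fun j => ?_
  simp only [Matrix.inv_def, Ring.inverse_eq_inv', Matrix.smul_apply, smul_eq_mul]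
  exact (continuous_id.matrix_det.measurable.inv).mul
    (((continuous_apply j).comp ((continuous_apply i).comp
      continuous_id.matrix_adjugate)).measurable)

theorem measurable_resolv (z : ℝ) :
    Measurable fun x : Matrix (Fin n) (Fin n) 𝕜 => resolv z x :=
  measurable_matrix_inv.comp (continuous_const.sub continuous_id).measurable

theorem measurable_centeredResolv (z : ℝ) :
    Measurable fun x : Matrix (Fin n) (Fin n) 𝕜 => centeredResolv z x := by
  have h : Continuous fun y : Matrix (Fin n) (Fin n) 𝕜 => y - (y.trace / n) • 1 :=
    continuous_id.sub ((continuous_id.matrix_trace.div_const _).smul continuous_const)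
  exact h.measurable.comp (measurable_resolv z)

theorem measurable_spikeStat (z : ℝ) :
    Measurable fun q : Matrix (Fin n) (Fin n) 𝕜 × Matrix (Fin n) (Fin n) 𝕜 =>
      spikeStat z q.1 q.2 := by
  have h1 : Measurable fun q : Matrix (Fin n) (Fin n) 𝕜 × Matrix (Fin n) (Fin n) 𝕜 =>
      centeredResolv z q.1 := (measurable_centeredResolv z).comp measurable_fst
  have h2 : Continuous fun y : Matrix (Fin n) (Fin n) 𝕜 × Matrix (Fin n) (Fin n) 𝕜 =>
      RCLike.re (y.2 * y.2 * y.1 * (y.2 * y.2) * y.1).trace :=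
    RCLike.continuous_re.comp ((((continuous_snd.mul continuous_snd).mul continuous_fst).mul
      (continuous_snd.mul continuous_snd)).mul continuous_fst).matrix_trace
  have h3 := h2.measurable.comp (h1.prodMk measurable_snd)
  exact h3

/-- The square of `spikeStat`, truncated to the event that `x ≤ c`. -/
noncomputable def truncStat (c z : ℝ)
    (q : Matrix (Fin n) (Fin n) 𝕜 × Matrix (Fin n) (Fin n) 𝕜) : ℝ≥0∞ :=
  (formLe n 𝕜 c).indicator (fun x => ENNReal.ofReal (spikeStat z x q.2 ^ 2)) q.1

theorem truncStat_of_mem {c z : ℝ} {x p : Matrix (Fin n) (Fin n) 𝕜} (h : x ∈ formLe n 𝕜 c) :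
    truncStat c z (x, p) = ENNReal.ofReal (spikeStat z x p ^ 2) := by
  rw [truncStat, Set.indicator_of_mem h]

theorem truncStat_of_notMem {c z : ℝ} {x p : Matrix (Fin n) (Fin n) 𝕜} (h : x ∉ formLe n 𝕜 c) :
    truncStat c z (x, p) = 0 := by
  rw [truncStat, Set.indicator_of_notMem h]

theorem measurable_truncStat (c z : ℝ) : Measurable (truncStat (𝕜 := 𝕜) (n := n) c z) := by
  have h1 := ((measurable_spikeStat (𝕜 := 𝕜) (n := n) z).pow_const 2).ennreal_ofReal.indicator
    (measurable_fst (measurableSet_formLe c))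
  have h2 : truncStat (𝕜 := 𝕜) (n := n) c z = (Prod.fst ⁻¹' formLe n 𝕜 c).indicator
      (fun q => ENNReal.ofReal (spikeStat z q.1 q.2 ^ 2)) := by
    funext q
    rw [truncStat]
    by_cases h : q.1 ∈ formLe n 𝕜 c
    · rw [Set.indicator_of_mem h, Set.indicator_of_mem (Set.mem_preimage.mpr h)]
    · rw [Set.indicator_of_notMem h,
        Set.indicator_of_notMem (fun h' => h (Set.mem_preimage.mp h'))]
  rw [h2]
  exact h1

theorem mem_formLe_conj (V : unitaryGroup (Fin n) 𝕜) (x : Matrix (Fin n) (Fin n) 𝕜) (c : ℝ)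
    (h : x ∈ formLe n 𝕜 c) : V.1 * x * star V.1 ∈ formLe n 𝕜 c := by
  intro v
  have h1 := h ((V⁻¹).1.toEuclideanLin v)
  have h2 : ‖(V⁻¹).1.toEuclideanLin v‖ ^ 2 = ‖v‖ ^ 2 := by
    rw [← inner_self_eq_norm_sq (𝕜 := 𝕜), inner_unitary, inner_self_eq_norm_sq]
  have h3 : hform x ((V⁻¹).1.toEuclideanLin v) = hform (V.1 * x * star V.1) v := by
    rw [hform, hform, inner_toEuclideanLin, inner_toEuclideanLin, toLpLin_apply, star_mulVec,
      UnitaryGroup.inv_val, ← mulVec_mulVec, ← mulVec_mulVec, dotProduct_mulVec _ V.1,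
      star_eq_conjTranspose, conjTranspose_conjTranspose]
  rw [← h3, ← h2]
  exact h1

theorem unitary_inv_conj (V : unitaryGroup (Fin n) 𝕜) (x : Matrix (Fin n) (Fin n) 𝕜) :
    (V⁻¹).1 * (V.1 * x * star V.1) * star (V⁻¹).1 = x := by
  rw [UnitaryGroup.inv_val, star_star]
  calc _ = (star V.1 * V.1) * x * (star V.1 * V.1) := by simp only [mul_assoc]
    _ = x := by rw [UnitaryGroup.star_mul_self, one_mul, mul_one]

theorem mem_formLe_conj_iff (V : unitaryGroup (Fin n) 𝕜) (x : Matrix (Fin n) (Fin n) 𝕜) (c : ℝ) :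
    V.1 * x * star V.1 ∈ formLe n 𝕜 c ↔ x ∈ formLe n 𝕜 c := by
  refine ⟨fun h => ?_, mem_formLe_conj V x c⟩
  have := mem_formLe_conj V⁻¹ _ c h
  rwa [unitary_inv_conj] at this

theorem resolv_conj (V : unitaryGroup (Fin n) 𝕜) (x : Matrix (Fin n) (Fin n) 𝕜) (z : ℝ) :
    resolv z (V.1 * x * star V.1) = V.1 * resolv z x * star V.1 := by
  have h1 : V.1⁻¹ = star V.1 := inv_eq_left_inv (UnitaryGroup.star_mul_self V)
  have h2 : (star V.1)⁻¹ = V.1 := inv_eq_left_inv V.2.2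
  rw [resolv, ← unitary_conj_smul_one V, ← sub_mul, ← mul_sub, Matrix.mul_inv_rev,
    Matrix.mul_inv_rev, h1, h2,
    resolv, mul_assoc]

theorem spikeStat_conj (V : unitaryGroup (Fin n) 𝕜) (x p : Matrix (Fin n) (Fin n) 𝕜) (z : ℝ) :
    spikeStat z (V.1 * x * star V.1) (V.1 * p * star V.1) = spikeStat z x p := by
  have h : centeredResolv z (V.1 * x * star V.1) = V.1 * centeredResolv z x * star V.1 := by
    rw [centeredResolv, resolv_conj, trace_unitary_conj, ← unitary_conj_smul_one V, ← sub_mul,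
      ← mul_sub, centeredResolv]
  rw [spikeStat, h]
  simp only [unitary_conj_diagonal_mul]
  rw [trace_unitary_conj, spikeStat]

theorem truncStat_conj (V : unitaryGroup (Fin n) 𝕜) (x p : Matrix (Fin n) (Fin n) 𝕜) (c z : ℝ) :
    truncStat c z (V.1 * x * star V.1, V.1 * p * star V.1) = truncStat c z (x, p) := by
  by_cases h : x ∈ formLe n 𝕜 c
  · rw [truncStat_of_mem h, truncStat_of_mem ((mem_formLe_conj_iff V x c).mpr h), spikeStat_conj]
  · rw [truncStat_of_notMem h, truncStat_of_notMem (fun h' => h ((mem_formLe_conj_iff V x c).mp h'))]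

variable {Ω : Type*} [MeasurableSpace Ω] {Pr : Measure Ω} [IsProbabilityMeasure Pr]
  {X P : Ω → Matrix (Fin n) (Fin n) 𝕜}

theorem measurable_conj (V : Matrix (Fin n) (Fin n) 𝕜) :
    Measurable fun x : Matrix (Fin n) (Fin n) 𝕜 => V * x * star V :=
  ((continuous_const.mul continuous_id).mul continuous_const).measurable

theorem lintegral_comp_eq_of_map_eq {α β : Type*} [MeasurableSpace α] [MeasurableSpace β]
    {f f' : Ω → α} {g g' : Ω → β} (hf : Measurable f) (hf' : Measurable f') (hg : Measurable g)
    (hg' : Measurable g') (h : IndepFun f g Pr) (h' : IndepFun f' g' Pr)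
    (hff : Pr.map f' = Pr.map f) (hgg : Pr.map g' = Pr.map g) {L : α × β → ℝ≥0∞}
    (hL : Measurable L) : ∫⁻ ω, L (f' ω, g' ω) ∂Pr = ∫⁻ ω, L (f ω, g ω) ∂Pr := by
  have h1 := (indepFun_iff_map_prod_eq_prod_map_map hf.aemeasurable hg.aemeasurable).mp h
  have h2 := (indepFun_iff_map_prod_eq_prod_map_map hf'.aemeasurable hg'.aemeasurable).mp h'
  rw [← lintegral_map (f := L) (g := fun ω => (f' ω, g' ω)) hL (hf'.prodMk hg'),
    ← lintegral_map (f := L) (g := fun ω => (f ω, g ω)) hL (hf.prodMk hg), h1, h2, hff, hgg]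

/-- If `P` is invariant this is equality of joint laws. If `X` is, the statistic is unchanged by
simultaneous conjugation, so conjugating `P` by `V` amounts to conjugating `X` by `V⁻¹`. -/
theorem lintegral_truncStat_conj (hX : Measurable X) (hP : Measurable P)
    (hindep : IndepFun X P Pr) (hinv : IsConjInvariant X Pr ∨ IsConjInvariant P Pr) (c z : ℝ)
    (V : unitaryGroup (Fin n) 𝕜) :
    ∫⁻ ω, truncStat c z (X ω, V.1 * P ω * star V.1) ∂Pr = ∫⁻ ω, truncStat c z (X ω, P ω) ∂Pr := by
  rcases hinv with h | h
  · have h1 : ∀ ω, truncStat c z (X ω, V.1 * P ω * star V.1) =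
        truncStat c z ((V⁻¹).1 * X ω * star (V⁻¹).1, P ω) := fun ω => by
      rw [← truncStat_conj V⁻¹ (X ω), unitary_inv_conj]
    simp_rw [h1]
    exact lintegral_comp_eq_of_map_eq hX ((measurable_conj _).comp hX) hP hP hindep
      (hindep.comp (measurable_conj (V⁻¹).1) measurable_id) (h _ (V⁻¹).2) rfl
      (measurable_truncStat c z)
  · exact lintegral_comp_eq_of_map_eq hX hX hP ((measurable_conj _).comp hP) hindep
      (hindep.comp measurable_id (measurable_conj V.1)) rfl (h _ V.2)
      (measurable_truncStat c z)

/-- The expectation is unchanged when `P` is conjugated by any fixed unitary, hence also after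
averaging over Haar measure. Tonelli moves that average inside, where for each fixed outcome the
deterministic bound applies. Independence and invariance enter the proof only here. -/
theorem lintegral_truncStat_le (hX : Measurable X) (hP : Measurable P)
    (hXH : ∀ ω, (X ω).IsHermitian) {r : ℕ} {θ : Fin r → ℝ}
    (hspikes : ∀ᵐ ω ∂Pr, ∃ u, HasSpikes (P ω) θ u)
    (hindep : IndepFun X P Pr) (hinv : IsConjInvariant X Pr ∨ IsConjInvariant P Pr) {z δ : ℝ}
    (hδ : 0 < δ) :
    ∫⁻ ω, truncStat (z - δ) z (X ω, P ω) ∂Pr ≤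
      ENNReal.ofReal (spikeConst θ δ / (n : ℝ) ^ 2) := by
  obtain ⟨ν, hν1, hν2⟩ := exists_haar_unitaryGroup (𝕜 := 𝕜) (n := n)
  have hmeas : Measurable fun q : unitaryGroup (Fin n) 𝕜 × Ω =>
      truncStat (z - δ) z (X q.2, q.1.1 * P q.2 * star q.1.1) := by
    have h1 : Continuous fun q : Matrix (Fin n) (Fin n) 𝕜 × Matrix (Fin n) (Fin n) 𝕜 =>
        q.1 * q.2 * star q.1 := (continuous_fst.mul continuous_snd).mul continuous_fst.star
    have h2 : Measurable fun q : unitaryGroup (Fin n) 𝕜 × Ω => (q.1.1, P q.2) :=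
      (measurable_subtype_coe.comp measurable_fst).prodMk (hP.comp measurable_snd)
    have h3 := (measurable_truncStat (z - δ) z).comp
      ((hX.comp measurable_snd).prodMk (h1.measurable.comp h2))
    exact h3
  calc ∫⁻ ω, truncStat (z - δ) z (X ω, P ω) ∂Pr
      = ∫⁻ _V : unitaryGroup (Fin n) 𝕜, ∫⁻ ω, truncStat (z - δ) z (X ω, P ω) ∂Pr ∂ν := by simp
    _ = ∫⁻ V : unitaryGroup (Fin n) 𝕜,
          ∫⁻ ω, truncStat (z - δ) z (X ω, V.1 * P ω * star V.1) ∂Pr ∂ν := by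
        simp_rw [lintegral_truncStat_conj hX hP hindep hinv]
    _ = ∫⁻ ω, ∫⁻ V : unitaryGroup (Fin n) 𝕜,
          truncStat (z - δ) z (X ω, V.1 * P ω * star V.1) ∂ν ∂Pr :=
        lintegral_lintegral_swap (f := fun (V : unitaryGroup (Fin n) 𝕜) ω =>
          truncStat (z - δ) z (X ω, V.1 * P ω * star V.1)) hmeas.aemeasurable
    _ ≤ ∫⁻ _ω, ENNReal.ofReal (spikeConst θ δ / (n : ℝ) ^ 2) ∂Pr := by
        refine lintegral_mono_ae ?_
        filter_upwards [hspikes] with ω ⟨u, hu⟩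
        by_cases hmem : X ω ∈ formLe n 𝕜 (z - δ)
        · simp_rw [truncStat_of_mem hmem]
          have hstat_int : Integrable (fun V : unitaryGroup (Fin n) 𝕜 =>
              spikeStat z (X ω) (V.1 * P ω * star V.1) ^ 2) ν :=
            integrable_of_continuous ν ((continuous_spikeStat_conj z _ _).pow 2)
          rw [← ofReal_integral_eq_lintegral_ofReal hstat_int (ae_of_all _ fun _ => sq_nonneg _)]
          exact ENNReal.ofReal_le_ofReal (integral_spikeStat_sq_le ν (hXH ω) hu hδ
            (lam_le_of_mem_formLe (hXH ω) hmem))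
        · simp_rw [truncStat_of_notMem hmem]
          simp
    _ = _ := by simp

end Expectation

end SpikedModel

namespace SpikedModel

open Matrix ComplexConjugate

/-! ### Eigenvalue limits along a deterministic sequence. -/

section Deterministic

variable {𝕜 : Type*} [RCLike 𝕜] {r : ℕ}

theorem resolv_properties {n : ℕ} {x : Matrix (Fin n) (Fin n) 𝕜} (hx : x.IsHermitian) {z : ℝ}
    (hz : lam hx 1 < z) :
    (∀ v, shift x z ((resolv z x).toEuclideanLin v) = v) ∧
      (resolv z x).toEuclideanLin.IsSymmetric ∧ (∀ v, hform x v ≤ z * ‖v‖ ^ 2) ∧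
      (resolv z x).trace = ((∑ i : Fin n, 1 / (z - lam hx (i + 1)) : ℝ) : 𝕜) ∧
      (centeredResolv z x).IsHermitian := by
  obtain ⟨W, hW⟩ := exists_unitary_diagonalization hx
  have hz' : ∀ i : Fin n, lam hx (i + 1) < z := fun i =>
    (lam_antitone hx le_rfl (by omega) i.2).trans_lt hz
  obtain ⟨h1, h2⟩ := resolv_spectral W (fun i : Fin n => lam hx (i + 1)) hW hz'
  refine ⟨fun v => ?_, ?_, fun v => mem_formLe_of_lam_one_le hx hz.le v,
    trace_resolv W _ hW hz', ?_⟩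
  · have h3 : ((z : 𝕜) • (1 : Matrix (Fin n) (Fin n) 𝕜) - x).toEuclideanLin
        ((resolv z x).toEuclideanLin v) =
        (((z : 𝕜) • (1 : Matrix (Fin n) (Fin n) 𝕜) - x) * resolv z x).toEuclideanLin v := by
      simp only [toLpLin_apply, mulVec_mulVec]
    rw [shift, h3, h2, toLpLin_one]
    rfl
  · rw [isSymmetric_toEuclideanLin_iff, h1]
    exact isHermitian_conj_diagonal W _
  · rw [centeredResolv_spectral W _ hW hz']
    exact isHermitian_conj_diagonal W _

variable {x p : (n : ℕ) → Matrix (Fin n) (Fin n) 𝕜} (hx : ∀ n, (x n).IsHermitian)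
  (hp : ∀ n, (p n).IsHermitian) {θ : Fin r → ℝ} {u : (n : ℕ) → Fin r → EuclideanSpace 𝕜 (Fin n)}

/-- The compressions of the resolvents at `z` to the spikes converge to `g` times the identity. -/
def KernelTendsto (x : (n : ℕ) → Matrix (Fin n) (Fin n) 𝕜)
    (u : (n : ℕ) → Fin r → EuclideanSpace 𝕜 (Fin n)) (z g : ℝ) : Prop :=
  ∀ j k, Tendsto (fun n => inner 𝕜 (u n j) ((resolv z (x n)).toEuclideanLin (u n k))) atTop
    (𝓝 (if j = k then (g : 𝕜) else 0))

/-- The compressed matrix `KΘK - K` tends to the diagonal matrix with entries `g (θᵢ g - 1)`,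
positive on `J`. -/
theorem eventually_le_lam_add (hu : ∀ᶠ n in atTop, HasSpikes (p n) θ (u n)) {z g : ℝ}
    (hz : ∀ᶠ n in atTop, lam (hx n) 1 < z) (hker : KernelTendsto x u z g) (hg : 0 < g)
    {J : Finset (Fin r)} (hJ : 1 ≤ J.card) (hJg : ∀ j ∈ J, 1 < θ j * g) :
    ∀ᶠ n in atTop, z ≤ lam ((hx n).add (hp n)) J.card := by
  have hform := eventually_re_form_nonneg (l := atTop) (𝕜 := 𝕜) (ι := J)
    (fun n i j => ∑ l, (θ l : 𝕜) * inner 𝕜 (u n i) ((resolv z (x n)).toEuclideanLin (u n l))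
      * inner 𝕜 (u n l) ((resolv z (x n)).toEuclideanLin (u n j))
        - inner 𝕜 (u n i) ((resolv z (x n)).toEuclideanLin (u n j)))
    (fun i => θ i * g * g - g) (fun i => by nlinarith [hJg i i.2]) (fun i j => by
      have h1 := (tendsto_finsetSum Finset.univ fun l _ =>
        ((tendsto_const_nhds (x := (θ l : 𝕜))).mul (hker i l)).mul (hker l j)).sub (hker i j)
      convert h1 using 2
      rw [Finset.sum_eq_single (i : Fin r)]
      · by_cases hij : i = j
        · subst hij
          simp
        · have : (i : Fin r) ≠ j := fun h => hij (Subtype.ext h)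
          simp [hij, this]
      · intro l _ hl
        simp [Ne.symm hl]
      · simp)
  filter_upwards [hu, hz, hform] with n hun hzn hfn
  obtain ⟨h1, h2, -⟩ := resolv_properties (hx n) hzn
  exact le_lam_add_of_form_nonneg (hx n) (hp n) hun h1 h2 hJ hfn

/-- On the positive subcritical spikes, `Θ - ΘKΘ` tends to the diagonal matrix with positive entries
`θᵢ (1 - θᵢ g)`. -/
theorem eventually_lam_add_le (hu : ∀ᶠ n in atTop, HasSpikes (p n) θ (u n)) {z g : ℝ}
    (hz : ∀ᶠ n in atTop, lam (hx n) 1 < z) (hker : KernelTendsto x u z g)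
    {J : Finset (Fin r)} {k : ℕ} (hJ : J.card < k) (hJg : ∀ j, j ∈ J ∨ θ j ≤ 0 ∨ θ j * g < 1) :
    ∀ᶠ n in atTop, lam ((hx n).add (hp n)) k ≤ z := by
  set J' : Finset (Fin r) := Finset.univ.filter fun j => 0 < θ j ∧ θ j * g < 1 with hJ'
  have hform := eventually_re_form_nonneg (l := atTop) (𝕜 := 𝕜) (ι := J')
    (fun n i j => (if i = j then (θ i : 𝕜) else 0) - θ i * θ j *
      inner 𝕜 (u n i) ((resolv z (x n)).toEuclideanLin (u n j)))
    (fun i => θ i - θ i * (θ i * g)) (fun i => by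
      have := (Finset.mem_filter.mp i.2).2
      nlinarith) (fun i j => by
      have h1 := (tendsto_const_nhds (x := (if i = j then (θ i : 𝕜) else 0))).sub
        ((tendsto_const_nhds (x := (θ i : 𝕜) * θ j)).mul (hker i j))
      convert h1 using 2
      by_cases hij : i = j
      · subst hij
        simp
        ring
      · have : (i : Fin r) ≠ j := fun h => hij (Subtype.ext h)
        simp [hij, this])
  filter_upwards [hu, hz, hform, eventually_ge_atTop k] with n hun hzn hfn hkn
  obtain ⟨h1, h2, h3, -⟩ := resolv_properties (hx n) hzn
  refine lam_add_le_of_form_nonneg (hx n) (hp n) hun h1 h2 h3 hJ hkn (J' := J') (fun j => ?_) hfn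
  rcases hJg j with h | h | h
  · exact Or.inl h
  · exact Or.inr (Or.inl h)
  · rcases le_or_gt (θ j) 0 with h0 | h0
    · exact Or.inr (Or.inl h0)
    · exact Or.inr (Or.inr (by simp [hJ', h, h0]))

theorem tendsto_lam_add (hu : ∀ᶠ n in atTop, HasSpikes (p n) θ (u n)) (hθ : Antitone θ) {b : ℝ}
    {G : ℝ → ℝ} (hG : StrictAntiOn G (Set.Ioi b)) (hGpos : ∀ z, b < z → 0 < G z)
    (hker : ∀ q : ℚ, b < q → KernelTendsto x u q (G q))
    (hlam : ∀ k, 1 ≤ k → Tendsto (fun n => lam (hx n) k) atTop (𝓝 b)) {k : ℕ} (hk : 1 ≤ k) {ℓ : ℝ}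
    (hℓ : (b < ℓ ∧ ∃ j : Fin r, (j : ℕ) + 1 = k ∧ 0 < θ j ∧ G ℓ = 1 / θ j) ∨
      (ℓ = b ∧ ∀ j : Fin r, (j : ℕ) + 1 = k → 0 < θ j → ∀ z, b < z → G z < 1 / θ j)) :
    Tendsto (fun n => lam ((hx n).add (hp n)) k) atTop (𝓝 ℓ) := by
  have hz : ∀ z : ℝ, b < z → ∀ᶠ n in atTop, lam (hx n) 1 < z := fun z hz =>
    (hlam 1 le_rfl).eventually_lt_const hz
  have hbℓ : b ≤ ℓ := by
    rcases hℓ with h | h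
    · exact h.1.le
    · exact h.1.ge
  have key : ∀ j : Fin r, (j : ℕ) + 1 = k → 0 < θ j → ∀ z, ℓ < z → θ j * G z < 1 := by
    intro j hj hj0 z hzℓ
    have h1 : G z < 1 / θ j := by
      rcases hℓ with ⟨hb, i, hi, hi0, hGi⟩ | ⟨hb, h⟩
      · have : i = j := Fin.ext (by omega)
        subst this
        rw [← hGi]
        exact hG hb (hb.trans hzℓ) hzℓ
      · exact h j hj hj0 z (hb ▸ hzℓ)
    rw [lt_div_iff₀ hj0] at h1
    linarith
  refine tendsto_order.mpr ⟨fun y hy => ?_, fun y hy => ?_⟩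
  · rcases hℓ with ⟨hb, j, hj, hj0, hGj⟩ | ⟨rfl, -⟩
    -- Below `ℓ` the `k`-th spike is supercritical at `q`, and so are the `k - 1` larger ones: a
    -- test space of dimension `k`. Rational points suffice, which later keeps the exceptional null
    -- sets countable in number.
    · obtain ⟨q, hq1, hq2⟩ := exists_rat_btwn (max_lt hy hb)
      have hbq : b < q := (le_max_right _ _).trans_lt hq1
      have hGq : 1 < θ j * G q := by
        have := hG hbq hb hq2
        rw [hGj, div_lt_iff₀ hj0] at this
        linarith
      have hcard : (Finset.Iic j).card = k := by rw [Fin.card_Iic, hj]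
      have h1 := eventually_le_lam_add hx hp hu (hz q hbq) (hker q hbq) (hGpos q hbq)
        (J := Finset.Iic j) (by rw [hcard]; exact hk) (fun i hi => by
          have := hθ (Finset.mem_Iic.mp hi)
          exact hGq.trans_le (mul_le_mul_of_nonneg_right this (hGpos q hbq).le))
      rw [hcard] at h1
      filter_upwards [h1] with n hn
      exact ((le_max_left _ _).trans_lt hq1).trans_le hn
    · filter_upwards [(hlam (k + r) (by omega)).eventually_const_lt hy, hu,
        eventually_ge_atTop (k + r)] with n hn hun hkn
      exact hn.trans_le (lam_add_rank_le_lam_add (hx n) (hp n) hun hk hkn)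
  · obtain ⟨q, hq1, hq2⟩ := exists_rat_btwn hy
    have hbq : b < q := hbℓ.trans_lt hq1
    -- Discard the first `k - 1` spikes; by monotonicity all others are nonpositive or subcritical
    -- at `q`. If `k > r`, discard them all.
    have hJ : ∃ J : Finset (Fin r), J.card < k ∧ ∀ j, j ∈ J ∨ θ j ≤ 0 ∨ θ j * G q < 1 := by
      by_cases hkr : k ≤ r
      · set j : Fin r := ⟨k - 1, by omega⟩ with hj
        refine ⟨Finset.Iio j, by rw [Fin.card_Iio]; simp only [hj]; omega, fun i => ?_⟩
        rcases lt_or_ge i j with hij | hij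
        · exact Or.inl (Finset.mem_Iio.mpr hij)
        · right
          have h1 := hθ hij
          rcases le_or_gt (θ j) 0 with h0 | h0
          · exact Or.inl (h1.trans h0)
          · right
            have h2 := key j (by simp only [hj]; omega) h0 q hq1
            exact (mul_le_mul_of_nonneg_right h1 (hGpos q hbq).le).trans_lt h2
      · exact ⟨Finset.univ, by rw [Finset.card_fin]; omega, fun i => Or.inl (Finset.mem_univ i)⟩
    obtain ⟨J, hJc, hJg⟩ := hJ
    filter_upwards [eventually_lam_add_le hx hp hu (hz q hbq) (hker q hbq) hJc hJg] with n hn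
    exact hn.trans_lt hq2

/-- An entry of the compressed resolvent is the centered entry plus the normalized trace times
`δⱼₖ`. The squared centered entry is at most `spikeStat / (θⱼ² θₖ²)`, and eventually the truncation
is inactive. -/
theorem kernelTendsto_of_truncStat (hu : ∀ᶠ n in atTop, HasSpikes (p n) θ (u n))
    (hθ0 : ∀ j, θ j ≠ 0) {z δ g : ℝ} (hδ : 0 < δ)
    (hz : ∀ᶠ n in atTop, lam (hx n) 1 < z - δ)
    (htr : Tendsto (fun n : ℕ => (n : ℝ)⁻¹ * ∑ i : Fin n, 1 / (z - lam (hx n) (i + 1))) atTop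
      (𝓝 g))
    (hstat : Tendsto (fun n => truncStat (z - δ) z (x n, p n)) atTop (𝓝 0)) :
    KernelTendsto x u z g := by
  intro j k
  have h1 : Tendsto (fun n => spikeStat z (x n) (p n) ^ 2) atTop (𝓝 0) := by
    have h2 := (ENNReal.tendsto_toReal ENNReal.zero_ne_top).comp hstat
    rw [ENNReal.toReal_zero] at h2
    refine h2.congr' ?_
    filter_upwards [hz] with n hn
    simp only [Function.comp]
    rw [truncStat_of_mem (mem_formLe_of_lam_one_le (hx n) hn.le),
      ENNReal.toReal_ofReal (sq_nonneg _)]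
  have h2 : Tendsto (fun n => spikeStat z (x n) (p n)) atTop (𝓝 0) := by
    have h3 := h1.sqrt
    rw [Real.sqrt_zero] at h3
    simp_rw [Real.sqrt_sq_eq_abs] at h3
    exact (tendsto_zero_iff_abs_tendsto_zero _).mpr h3
  have hc : 0 < θ j ^ 2 * θ k ^ 2 := by
    have := hθ0 j
    have := hθ0 k
    positivity
  have h4 : Tendsto (fun n => inner 𝕜 (u n j) ((centeredResolv z (x n)).toEuclideanLin (u n k)))
      atTop (𝓝 0) := by
    rw [tendsto_zero_iff_norm_tendsto_zero]
    have h5 := (h2.div_const (θ j ^ 2 * θ k ^ 2)).sqrt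
    rw [zero_div, Real.sqrt_zero] at h5
    refine tendsto_of_tendsto_of_tendsto_of_le_of_le' tendsto_const_nhds h5
      (Eventually.of_forall fun n => norm_nonneg _) ?_
    filter_upwards [hu, hz] with n hun hzn
    refine Real.le_sqrt_of_sq_le ?_
    have hH := (resolv_properties (hx n) (show lam (hx n) 1 < z by linarith)).2.2.2.2
    rw [le_div_iff₀ hc, spikeStat_eq hun hH]
    have h6 : ∀ j k : Fin r, 0 ≤ θ j ^ 2 * θ k ^ 2 *
      ‖inner 𝕜 (u n j) ((centeredResolv z (x n)).toEuclideanLin (u n k))‖ ^ 2 :=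
        fun j k => by positivity
    have h7 := Finset.single_le_sum (f := fun k => θ j ^ 2 * θ k ^ 2 *
      ‖inner 𝕜 (u n j) ((centeredResolv z (x n)).toEuclideanLin (u n k))‖ ^ 2)
      (fun k _ => h6 j k) (Finset.mem_univ k)
    have h8 := Finset.single_le_sum (f := fun j => ∑ k, θ j ^ 2 * θ k ^ 2 *
      ‖inner 𝕜 (u n j) ((centeredResolv z (x n)).toEuclideanLin (u n k))‖ ^ 2)
      (fun j _ => Finset.sum_nonneg fun k _ => h6 j k) (Finset.mem_univ j)
    linarith
  have h5 : Tendsto (fun n : ℕ => (((n : ℝ)⁻¹ * ∑ i : Fin n, 1 / (z - lam (hx n) (i + 1)) : ℝ) : 𝕜)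
      * (if j = k then 1 else 0)) atTop (𝓝 ((g : 𝕜) * (if j = k then 1 else 0))) :=
    ((RCLike.continuous_ofReal.tendsto g).comp htr).mul tendsto_const_nhds
  have h6 := h4.add h5
  rw [zero_add, mul_ite, mul_one, mul_zero] at h6
  refine h6.congr' ?_
  filter_upwards [hu, hz] with n hun hzn
  have htrace := (resolv_properties (hx n) (show lam (hx n) 1 < z by linarith)).2.2.2.1
  rw [centeredResolv, htrace, map_sub, LinearMap.sub_apply, inner_sub_right, map_smul,
    LinearMap.smul_apply, toLpLin_one, LinearMap.id_apply, inner_smul_right,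
    orthonormal_iff_ite.mp hun.1 j k]
  push_cast
  ring

/-- If the `k`-th eigenvalue were at most `c < b`, fewer than `k` eigenvalues would exceed `c`, and
the empirical mean of a bump supported above `c` would be at most `k / n`. Its limit is positive
because `μ` charges every neighbourhood of `b`. -/
theorem tendsto_lam_of_empirical {μ : Measure ℝ} [IsProbabilityMeasure μ] {b : ℝ}
    (hb : ∀ c < b, 0 < μ (Set.Ioi c))
    (hconv : ∀ f : BoundedContinuousFunction ℝ ℝ, Tendsto (fun n : ℕ => (n : ℝ)⁻¹ *
      ∑ i : Fin n, f (lam (hx n) (i + 1))) atTop (𝓝 (∫ t, f t ∂μ)))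
    (hmax : Tendsto (fun n => lam (hx n) 1) atTop (𝓝 b)) (k : ℕ) (hk : 1 ≤ k) :
    Tendsto (fun n => lam (hx n) k) atTop (𝓝 b) := by
  refine tendsto_order.mpr ⟨fun c hc => ?_, fun c hc => ?_⟩
  · set f : BoundedContinuousFunction ℝ ℝ := BoundedContinuousFunction.ofNormedAddCommGroup
      (fun t => min 1 (max 0 (t - c))) (by fun_prop) 1 (fun t => by
        rw [Real.norm_eq_abs, abs_le]
        exact ⟨by linarith [le_min zero_le_one (le_max_left 0 (t - c))], min_le_left _ _⟩) with hf
    have hf0 : ∀ t, 0 ≤ f t := fun t => le_min zero_le_one (le_max_left _ _)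
    have hf1 : ∀ t, f t ≤ 1 := fun t => min_le_left _ _
    have hfc : ∀ t, t ≤ c → f t = 0 := fun t ht => by
      simp [hf, ht]
    have hpos : 0 < ∫ t, f t ∂μ := by
      rw [integral_pos_iff_support_of_nonneg hf0 (f.integrable μ)]
      refine (hb c hc).trans_le (measure_mono fun t ht => ?_)
      rw [Function.mem_support]
      have : 0 < t - c := sub_pos.mpr ht
      exact (lt_min zero_lt_one (lt_max_of_lt_right this)).ne'
    have h1 : Tendsto (fun n : ℕ => (n : ℝ)⁻¹ * k) atTop (𝓝 (0 * k)) :=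
      (tendsto_inv_atTop_nhds_zero_nat (𝕜 := ℝ)).mul_const _
    rw [zero_mul] at h1
    filter_upwards [h1.eventually_lt (hconv f) hpos, eventually_ge_atTop k,
      eventually_gt_atTop 0] with n hn hkn hn0
    by_contra hcon
    push Not at hcon
    have hn0' : (0 : ℝ) < (n : ℝ)⁻¹ := by positivity
    have h2 : (k : ℝ) < ∑ i : Fin n, f (lam (hx n) (i + 1)) := lt_of_mul_lt_mul_left hn hn0'.le
    have h3 : ∑ i : Fin n, f (lam (hx n) (i + 1)) ≤
        ∑ i : Fin n, if i ∈ Finset.Iio (⟨k - 1, by omega⟩ : Fin n) then (1 : ℝ) else 0 := by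
      refine Finset.sum_le_sum fun i _ => ?_
      split_ifs with hi
      · exact hf1 _
      · rw [Finset.mem_Iio, Fin.lt_def, not_lt] at hi
        simp only at hi
        exact (hfc _ ((lam_antitone (hx n) hk (by omega) i.2).trans hcon)).le
    rw [Finset.sum_boole, Finset.filter_mem_eq_inter, Finset.univ_inter, Fin.card_Iio] at h3
    have h4 : ((k - 1 : ℕ) : ℝ) ≤ k := by exact_mod_cast Nat.sub_le k 1
    simp only at h3
    linarith
  · filter_upwards [hmax.eventually_lt_const hc, eventually_ge_atTop k] with n hn hkn
    exact (lam_antitone (hx n) le_rfl hk hkn).trans_lt hn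

end Deterministic

end SpikedModel

namespace SpikedModel

open Matrix ComplexConjugate

/-! ### The Cauchy transform to the right of the support. -/

section CauchyTransform

variable {μ : Measure ℝ} [IsProbabilityMeasure μ] {b : ℝ}

theorem integral_pos_of_ae_pos {f : ℝ → ℝ} (hf : Integrable f μ) (h : ∀ᵐ t ∂μ, 0 < f t) :
    0 < ∫ t, f t ∂μ := by
  rw [integral_pos_iff_support_of_nonneg_ae (h.mono fun t ht => ht.le) hf]
  refine pos_iff_ne_zero.mpr fun h0 => ?_
  obtain ⟨t, ht1, ht2⟩ := ((measure_eq_zero_iff_ae_notMem.mp h0).and h).exists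
  exact ht1 ht2.ne'

theorem integrable_cauchy_kernel (hμb : ∀ᵐ t ∂μ, t ≤ b) {z : ℝ} (hz : b < z) :
    Integrable (fun t => 1 / (z - t)) μ := by
  refine Integrable.of_bound (C := 1 / (z - b))
    (measurable_const.div (measurable_const.sub measurable_id)).aestronglyMeasurable ?_
  filter_upwards [hμb] with t ht
  rw [Real.norm_eq_abs, abs_of_nonneg (one_div_nonneg.mpr (by linarith))]
  exact one_div_le_one_div_of_le (by linarith) (by linarith)

theorem cauchyTransform_pos (hμb : ∀ᵐ t ∂μ, t ≤ b) {z : ℝ} (hz : b < z) :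
    0 < cauchyTransform μ z := by
  refine integral_pos_of_ae_pos (integrable_cauchy_kernel hμb hz) ?_
  filter_upwards [hμb] with t ht
  exact one_div_pos.mpr (by linarith)

theorem cauchyTransform_le (hμb : ∀ᵐ t ∂μ, t ≤ b) {z : ℝ} (hz : b < z) :
    cauchyTransform μ z ≤ 1 / (z - b) := by
  have h : cauchyTransform μ z ≤ ∫ _t, 1 / (z - b) ∂μ := by
    refine integral_mono_ae (integrable_cauchy_kernel hμb hz) (integrable_const _) ?_
    filter_upwards [hμb] with t ht
    exact one_div_le_one_div_of_le (by linarith) (by linarith)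
  simpa using h

theorem cauchyTransform_strictAntiOn (hμb : ∀ᵐ t ∂μ, t ≤ b) :
    StrictAntiOn (cauchyTransform μ) (Set.Ioi b) := by
  intro z hz w hw hzw
  have h1 := integrable_cauchy_kernel hμb hz
  have h2 := integrable_cauchy_kernel hμb hw
  have h3 : 0 < ∫ t, (1 / (z - t) - 1 / (w - t)) ∂μ := by
    refine integral_pos_of_ae_pos (h1.sub h2) ?_
    filter_upwards [hμb] with t ht
    have hz' : b < z := hz
    exact sub_pos.mpr (one_div_lt_one_div_of_lt (by linarith) (by linarith))
  rw [integral_sub h1 h2] at h3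
  exact sub_pos.mp h3

theorem continuousOn_cauchyTransform (hμb : ∀ᵐ t ∂μ, t ≤ b) :
    ContinuousOn (cauchyTransform μ) (Set.Ioi b) := by
  intro z hz
  have hz' : b < z := hz
  refine ContinuousAt.continuousWithinAt ?_
  refine continuousAt_of_dominated (bound := fun _ => 1 / ((z - b) / 2))
    (Eventually.of_forall fun w =>
      (measurable_const.div (measurable_const.sub measurable_id)).aestronglyMeasurable) ?_ (integrable_const _) ?_
  · filter_upwards [lt_mem_nhds (show (z + b) / 2 < z by linarith)] with w hw
    filter_upwards [hμb] with t ht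
    rw [Real.norm_eq_abs, abs_of_nonneg (one_div_nonneg.mpr (by linarith))]
    exact one_div_le_one_div_of_le (by linarith) (by linarith)
  · filter_upwards [hμb] with t ht
    exact continuousAt_const.div (continuousAt_id.sub continuousAt_const)
      (sub_pos.mpr (ht.trans_lt hz')).ne'

end CauchyTransform

/-! ### From moment bounds to almost sure limits at the upper edge. -/

section AlmostSure

variable {𝕜 : Type*} [RCLike 𝕜] {Ω : Type*} [MeasurableSpace Ω] {Pr : Measure Ω}
  [IsProbabilityMeasure Pr] {X P : (n : ℕ) → Ω → Matrix (Fin n) (Fin n) 𝕜}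

/-- The expectations are `O(n⁻²)`, so the series has finite expectation, converges almost surely,
and its terms tend to zero. The shift by `r` is there because the hypotheses concern `n ≥ r` only.
-/
theorem ae_tendsto_truncStat (hXm : ∀ n, Measurable (X n)) (hPm : ∀ n, Measurable (P n))
    (hX : ∀ n ω, (X n ω).IsHermitian) {r : ℕ} {θ : Fin r → ℝ}
    (hspikes : ∀ n, r ≤ n → ∀ᵐ ω ∂Pr, ∃ u, HasSpikes (P n ω) θ u)
    (hindep : ∀ n, r ≤ n → IndepFun (X n) (P n) Pr)
    (hinv : ∀ n, r ≤ n → IsConjInvariant (X n) Pr ∨ IsConjInvariant (P n) Pr) {z δ : ℝ}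
    (hδ : 0 < δ) :
    ∀ᵐ ω ∂Pr, Tendsto (fun n => truncStat (z - δ) z (X n ω, P n ω)) atTop (𝓝 0) := by
  have hm : ∀ n, Measurable fun ω => truncStat (z - δ) z (X n ω, P n ω) := fun n =>
    (measurable_truncStat (z - δ) z).comp ((hXm n).prodMk (hPm n))
  have hsum : ∫⁻ ω, ∑' n, truncStat (z - δ) z (X (n + r) ω, P (n + r) ω) ∂Pr ≠ ∞ := by
    rw [lintegral_tsum fun n => (hm _).aemeasurable]
    have h1 : Summable fun n : ℕ => spikeConst θ δ / ((n + r : ℕ) : ℝ) ^ 2 := by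
      have h2 : Summable fun n : ℕ => spikeConst θ δ / (n : ℝ) ^ 2 := by
        simp_rw [div_eq_mul_inv]
        exact (Real.summable_nat_pow_inv.mpr one_lt_two).mul_left _
      exact (summable_nat_add_iff r).mpr h2
    refine ne_top_of_le_ne_top h1.tsum_ofReal_ne_top (ENNReal.tsum_le_tsum fun n => ?_)
    have hn : r ≤ n + r := Nat.le_add_left _ _
    exact lintegral_truncStat_le (hXm _) (hPm _) (hX _) (hspikes _ hn) (hindep _ hn)
      (hinv _ hn) hδ
  filter_upwards [ae_lt_top (Measurable.tsum fun n => hm (n + r)) hsum] with ω hω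
  exact (tendsto_add_atTop_iff_nat r).mp
    (ENNReal.tendsto_atTop_zero_of_tsum_ne_top hω.ne)

/-- The function `1 / (z - t)` is not bounded, so weak convergence is applied to `1 / max (z - t)
δ`, which agrees with it for `t ≤ z - δ`, hence `μ`-almost everywhere and eventually at all
eigenvalues. -/
theorem tendsto_mean_resolvent {x : (n : ℕ) → Matrix (Fin n) (Fin n) 𝕜}
    (hx : ∀ n, (x n).IsHermitian) {μ : Measure ℝ} {b : ℝ}
    (hμb : ∀ᵐ t ∂μ, t ≤ b)
    (hconv : ∀ f : BoundedContinuousFunction ℝ ℝ, Tendsto (fun n : ℕ => (n : ℝ)⁻¹ *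
      ∑ i : Fin n, f (lam (hx n) (i + 1))) atTop (𝓝 (∫ t, f t ∂μ))) {z δ : ℝ} (hδ : 0 < δ)
    (hbz : b ≤ z - δ) (hz : ∀ᶠ n in atTop, lam (hx n) 1 < z - δ) :
    Tendsto (fun n : ℕ => (n : ℝ)⁻¹ * ∑ i : Fin n, 1 / (z - lam (hx n) (i + 1))) atTop
      (𝓝 (cauchyTransform μ z)) := by
  have hpos : ∀ t, 0 < max (z - t) δ := fun t => lt_max_of_lt_right hδ
  set f : BoundedContinuousFunction ℝ ℝ := BoundedContinuousFunction.ofNormedAddCommGroup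
    (fun t => 1 / max (z - t) δ)
    (continuous_const.div (by fun_prop) fun t => (hpos t).ne') (1 / δ) (fun t => by
      rw [Real.norm_eq_abs, abs_of_nonneg (one_div_nonneg.mpr (hpos t).le)]
      exact one_div_le_one_div_of_le hδ (le_max_right _ _)) with hf
  have hft : ∀ t, t ≤ z - δ → f t = 1 / (z - t) := fun t ht => by
    simp only [hf, BoundedContinuousFunction.coe_ofNormedAddCommGroup]
    rw [max_eq_left (by linarith)]
  have h1 : ∫ t, f t ∂μ = cauchyTransform μ z := by
    refine integral_congr_ae ?_
    filter_upwards [hμb] with t ht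
    exact hft t (ht.trans hbz)
  rw [← h1]
  refine (hconv f).congr' ?_
  filter_upwards [hz] with n hn
  congr 1
  refine Finset.sum_congr rfl fun i _ => hft _ ?_
  exact (lam_antitone (hx n) le_rfl (by omega) i.2).trans hn.le

/-- The limits of the largest eigenvalues of a spiked random matrix. -/
theorem ae_tendsto_lam_add (hXm : ∀ n, Measurable (X n)) (hPm : ∀ n, Measurable (P n))
    (hX : ∀ n ω, (X n ω).IsHermitian) (hP : ∀ n ω, (P n ω).IsHermitian) {μ : Measure ℝ}
    [IsProbabilityMeasure μ] {b : ℝ} (hμb : ∀ᵐ t ∂μ, t ≤ b) (hb : ∀ c < b, 0 < μ (Set.Ioi c))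
    (hconv : ∀ᵐ ω ∂Pr, ∀ f : BoundedContinuousFunction ℝ ℝ, Tendsto (fun n : ℕ => (n : ℝ)⁻¹ *
      ∑ i : Fin n, f (lam (hX n ω) (i + 1))) atTop (𝓝 (∫ t, f t ∂μ)))
    (hmax : ∀ᵐ ω ∂Pr, Tendsto (fun n => lam (hX n ω) 1) atTop (𝓝 b))
    {r : ℕ} {θ : Fin r → ℝ} (hθ : Antitone θ) (hθ0 : ∀ j, θ j ≠ 0)
    (hspikes : ∀ n, r ≤ n → ∀ᵐ ω ∂Pr, ∃ u, HasSpikes (P n ω) θ u)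
    (hindep : ∀ n, r ≤ n → IndepFun (X n) (P n) Pr)
    (hinv : ∀ n, r ≤ n → IsConjInvariant (X n) Pr ∨ IsConjInvariant (P n) Pr)
    {k : ℕ} (hk : 1 ≤ k) {ℓ : ℝ}
    (hℓ : (b < ℓ ∧ ∃ j : Fin r, (j : ℕ) + 1 = k ∧ 0 < θ j ∧ cauchyTransform μ ℓ = 1 / θ j) ∨
      (ℓ = b ∧ ∀ j : Fin r, (j : ℕ) + 1 = k → 0 < θ j → ∀ z, b < z →
        cauchyTransform μ z < 1 / θ j)) :
    ∀ᵐ ω ∂Pr, Tendsto (fun n => lam ((hX n ω).add (hP n ω)) k) atTop (𝓝 ℓ) := by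
  -- One almost sure event serves all rational `q > b`; the truncation level is the midpoint of `b`
  -- and `q`.
  have hstat : ∀ᵐ ω ∂Pr, ∀ q : {q : ℚ // b < q},
      Tendsto (fun n => truncStat ((q : ℝ) - ((q : ℝ) - b) / 2) q (X n ω, P n ω)) atTop (𝓝 0) :=
    ae_all_iff.mpr fun q => ae_tendsto_truncStat hXm hPm hX hspikes hindep hinv
      (half_pos (sub_pos.mpr q.2))
  have hsp : ∀ᵐ ω ∂Pr, ∀ n, r ≤ n → ∃ u, HasSpikes (P n ω) θ u := by
    refine ae_all_iff.mpr fun n => ?_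
    by_cases hn : r ≤ n
    · filter_upwards [hspikes n hn] with ω hω _
      exact hω
    · exact ae_of_all _ fun ω h => absurd h hn
  filter_upwards [hconv, hmax, hstat, hsp] with ω hcω hmω hsω hpω
  -- The outcome `ω` is fixed by now, so the eigenvectors may be chosen without regard to
  -- measurability.
  choose! u hu using hpω
  have hu' : ∀ᶠ n in atTop, HasSpikes (P n ω) θ (u n) := by
    filter_upwards [eventually_ge_atTop r] with n hn
    exact hu n hn
  refine tendsto_lam_add (fun n => hX n ω) (fun n => hP n ω) hu' hθ
    (cauchyTransform_strictAntiOn hμb) (fun z hz => cauchyTransform_pos hμb hz)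
    (fun q hq => ?_) (tendsto_lam_of_empirical _ hb hcω hmω) hk hℓ
  have hδ : 0 < ((q : ℝ) - b) / 2 := half_pos (sub_pos.mpr hq)
  have hz : ∀ᶠ n in atTop, lam (hX n ω) 1 < (q : ℝ) - ((q : ℝ) - b) / 2 :=
    hmω.eventually_lt_const (by linarith)
  exact kernelTendsto_of_truncStat (fun n => hX n ω) hu' hθ0 hδ hz
    (tendsto_mean_resolvent (fun n => hX n ω) hμb hcω hδ (by linarith) hz) (hsω ⟨q, hq⟩)

end AlmostSure

end SpikedModel

namespace SpikedModel

open Matrix ComplexConjugate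

/-! ### Spectral decomposition of the perturbation from its multiset of eigenvalues. -/

section Spikes

variable {𝕜 : Type*} [RCLike 𝕜] {n : ℕ}

theorem card_fiber_eq_count {α γ : Type*} [DecidableEq γ] (s : Finset α) (f : α → γ) (c : γ) :
    Fintype.card {a : s // f a = c} = (s.val.map f).count c := by
  rw [Multiset.count_map, Fintype.card_subtype, Finset.card_filter,
    Finset.sum_coe_sort s fun a => if f a = c then 1 else 0, ← Finset.card_filter]
  simp only [eq_comm]
  rfl

/-- Equal image multisets mean that the fibres over each value have equal cardinality; bijections of
the fibres glue. -/
theorem exists_equiv_of_map_eq {α β γ : Type*} [DecidableEq γ] {s : Finset α} {t : Finset β}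
    {f : α → γ} {g : β → γ} (h : s.val.map f = t.val.map g) :
    ∃ e : s ≃ t, ∀ a, g (e a) = f a := by
  have e : ∀ c, {a : s // f a = c} ≃ {b : t // g b = c} := fun c =>
    Fintype.equivOfCardEq (by rw [card_fiber_eq_count, card_fiber_eq_count, h])
  exact ⟨Equiv.ofFiberEquiv e, fun a => Equiv.ofFiberEquiv_map e a⟩

theorem hasSpikes_of_map_lam {p : Matrix (Fin n) (Fin n) 𝕜} (hp : p.IsHermitian) {r : ℕ}
    {θ : ℕ → ℝ} (h : ((Finset.Icc 1 n).val.map (lam hp)).filter (fun x => x ≠ 0) =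
        (Finset.Icc 1 r).val.map θ) :
    ∃ u, HasSpikes p (fun j : Fin r => θ (j + 1)) u := by
  obtain ⟨e, he⟩ := exists_sorted_eigenbasis hp
  have hIcc : ∀ (m : ℕ) (f : ℕ → ℝ), (Finset.Icc 1 m).val.map f =
      (Finset.univ : Finset (Fin m)).val.map (fun i : Fin m => f ((i : ℕ) + 1)) := by
    intro m f
    have hinj : Function.Injective fun i : Fin m => (i : ℕ) + 1 := fun i j hij =>
      Fin.ext (Nat.succ_injective hij)
    have h1 : Finset.Icc 1 m = (Finset.univ : Finset (Fin m)).map ⟨_, hinj⟩ := by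
      ext k
      rw [Finset.mem_Icc, Finset.mem_map]
      constructor
      · rintro ⟨h1, h2⟩
        exact ⟨⟨k - 1, by omega⟩, Finset.mem_univ _, Nat.sub_add_cancel h1⟩
      · rintro ⟨i, -, rfl⟩
        exact ⟨Nat.succ_pos _, i.2⟩
    rw [h1, Finset.map_val, Multiset.map_map]
    rfl
  rw [hIcc, hIcc, Multiset.filter_map] at h
  obtain ⟨σ, hσ⟩ := exists_equiv_of_map_eq (s := Finset.univ.filter
    fun i : Fin n => lam hp (i + 1) ≠ 0) (t := (Finset.univ : Finset (Fin r))) h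
  refine ⟨fun j => e (σ.symm ⟨j, Finset.mem_univ j⟩), ?_, fun w => ?_⟩
  · refine e.orthonormal.comp _ fun i j hij => ?_
    have := σ.symm.injective (Subtype.ext hij)
    exact congrArg Subtype.val this
  · have h1 : p.toEuclideanLin w =
        ∑ i : Fin n, ((lam hp (i + 1) : 𝕜) * inner 𝕜 (e i) w) • e i := by
      conv_lhs => rw [← e.sum_repr' w, map_sum]
      refine Finset.sum_congr rfl fun i _ => ?_
      rw [map_smul, he, smul_smul, mul_comm]
    have h2 : ∑ i : Fin n, ((lam hp (i + 1) : 𝕜) * inner 𝕜 (e i) w) • e i =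
        ∑ i ∈ Finset.univ.filter (fun i : Fin n => lam hp (i + 1) ≠ 0),
          ((lam hp (i + 1) : 𝕜) * inner 𝕜 (e i) w) • e i := by
      refine (Finset.sum_subset (Finset.filter_subset _ _) fun i _ hi => ?_).symm
      have : lam hp (i + 1) = 0 := by simpa using hi
      simp [this]
    rw [h1, h2, ← Finset.sum_coe_sort, ← Equiv.sum_comp σ.symm]
    rw [← Finset.sum_coe_sort (Finset.univ : Finset (Fin r))]
    refine Finset.sum_congr rfl fun j _ => ?_
    have h3 := hσ (σ.symm j)
    rw [Equiv.apply_symm_apply] at h3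
    rw [← h3]

/-- The index is reversed so that decreasing spikes stay decreasing after negation. -/
theorem HasSpikes.neg {r : ℕ} {p : Matrix (Fin n) (Fin n) 𝕜} {θ : Fin r → ℝ}
    {u : Fin r → EuclideanSpace 𝕜 (Fin n)} (h : HasSpikes p θ u) :
    HasSpikes (-p) (fun j => -θ j.rev) (fun j => u j.rev) := by
  refine ⟨h.1.comp _ Fin.rev_injective, fun w => ?_⟩
  rw [map_neg, LinearMap.neg_apply, h.2, ← Equiv.sum_comp Fin.revPerm, ← Finset.sum_neg_distrib]
  refine Finset.sum_congr rfl fun j _ => ?_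
  rw [Fin.revPerm_apply, RCLike.ofReal_neg, neg_mul, neg_smul]

end Spikes

/-! ### The threshold at each edge, and reflection of the measure. -/

section Edges

variable {μ : Measure ℝ} {a b : ℝ}

theorem ae_map_neg_le (hμa : ∀ᵐ t ∂μ, a ≤ t) : ∀ᵐ t ∂(μ.map Neg.neg), t ≤ -a := by
  rw [ae_map_iff measurable_neg.aemeasurable measurableSet_Iic]
  filter_upwards [hμa] with t ht
  exact neg_le_neg ht

theorem cauchyInverse_spec (hull : convexHull ℝ μ.support = Set.Icc a b) {x y : ℝ}
    (hx : x < a ∨ b < x) (hxy : cauchyTransform μ x = y) :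
    (cauchyInverse μ y < a ∨ b < cauchyInverse μ y) ∧
      cauchyTransform μ (cauchyInverse μ y) = y := by
  have hmem : ∀ t, t ∈ (convexHull ℝ μ.support)ᶜ ↔ t < a ∨ b < t := fun t => by
    rw [hull, Set.mem_compl_iff, Set.mem_Icc, not_and_or, not_le, not_le]
  have hex : ∃ t ∈ (convexHull ℝ μ.support)ᶜ, cauchyTransform μ t = y := ⟨x, (hmem x).mpr hx, hxy⟩
  exact ⟨(hmem _).mp (Function.invFunOn_mem hex), Function.invFunOn_eq hex⟩

theorem cauchyTransform_map_neg (z : ℝ) :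
    cauchyTransform (μ.map Neg.neg) z = - cauchyTransform μ (-z) := by
  have hm : Measurable fun t : ℝ => 1 / (z - t) :=
    measurable_const.div (measurable_const.sub measurable_id)
  rw [cauchyTransform, cauchyTransform,
    integral_map measurable_neg.aemeasurable hm.aestronglyMeasurable, ← integral_neg]
  congr 1 with t
  rw [← div_neg]
  congr 1
  ring

variable [IsProbabilityMeasure μ]

theorem tendsto_cauchyRight (hμb : ∀ᵐ t ∂μ, t ≤ b) :
    Tendsto (fun z => (cauchyTransform μ z : EReal)) (𝓝[>] b) (𝓝 (cauchyRight μ b)) ∧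
      cauchyRight μ b = sSup ((fun z => (cauchyTransform μ z : EReal)) '' Set.Ioi b) := by
  have h1 : AntitoneOn (fun z => (cauchyTransform μ z : EReal)) (Set.Ioi b) := fun z hz w hw hzw =>
    EReal.coe_le_coe_iff.mpr ((cauchyTransform_strictAntiOn hμb).antitoneOn hz hw hzw)
  have h2 := h1.tendsto_nhdsGT (OrderTop.bddAbove _)
  have h3 : cauchyRight μ b = _ := rightLim_eq_of_tendsto h2
  exact ⟨h3 ▸ h2, h3⟩

/-- The boundary value is the supremum of `G` over `(b, ∞)`, so `θ > 1 / G(b⁺)` means that `G`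
exceeds `1 / θ` somewhere; since `G` is continuous and decays, it then takes the value `1 / θ`. -/
theorem exists_cauchyTransform_eq_or (hμb : ∀ᵐ t ∂μ, t ≤ b) {θ : ℝ} (hθ : 0 < θ) :
    ((θ : EReal) > 1 / cauchyRight μ b → ∃ ρ, b < ρ ∧ cauchyTransform μ ρ = 1 / θ) ∧
      (¬ (θ : EReal) > 1 / cauchyRight μ b → ∀ z, b < z → cauchyTransform μ z < 1 / θ) := by
  have hg := (tendsto_cauchyRight hμb).2
  set g := cauchyRight μ b with hgdef
  have hle : ∀ z, b < z → (cauchyTransform μ z : EReal) ≤ g := fun z hz => by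
    rw [hg]
    exact le_sSup ⟨z, hz, rfl⟩
  have hg0 : 0 < g := lt_of_lt_of_le (by
    exact_mod_cast cauchyTransform_pos hμb (lt_add_one b)) (hle _ (lt_add_one b))
  have hiff : (θ : EReal) > 1 / g ↔ ((1 / θ : ℝ) : EReal) < g := by
    induction hgg : g with
    | bot => rw [hgg] at hg0; exact absurd hg0 not_lt_bot
    | top =>
      simp only [EReal.div_top, gt_iff_lt, EReal.coe_lt_top, iff_true]
      exact_mod_cast hθ
    | coe y =>
      have hy : 0 < y := by
        rw [hgg] at hg0
        exact_mod_cast hg0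
      rw [show (1 : EReal) = ((1 : ℝ) : EReal) from rfl, ← EReal.coe_div, gt_iff_lt,
        EReal.coe_lt_coe_iff, EReal.coe_lt_coe_iff, div_lt_iff₀ hy, div_lt_iff₀ hθ, mul_comm]
  rw [hiff]
  refine ⟨fun h => ?_, fun h z hz => ?_⟩
  · rw [hg] at h
    obtain ⟨_, ⟨z₀, hz₀, rfl⟩, h0⟩ := lt_sSup_iff.mp h
    have hz₀' : b < z₀ := hz₀
    have h0' : 1 / θ < cauchyTransform μ z₀ := EReal.coe_lt_coe_iff.mp h0
    -- A point at distance at least `θ` from `b`, where `G(z) ≤ 1 / (z - b)` falls below `1 / θ`.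
    have hbw : b < max z₀ (b + 2 * θ) := lt_max_of_lt_left hz₀'
    have h1 : cauchyTransform μ (max z₀ (b + 2 * θ)) ≤ 1 / θ := by
      refine (cauchyTransform_le hμb hbw).trans (one_div_le_one_div_of_le hθ ?_)
      linarith [le_max_right z₀ (b + 2 * θ)]
    have hcont : ContinuousOn (cauchyTransform μ) (Set.Icc z₀ (max z₀ (b + 2 * θ))) :=
      (continuousOn_cauchyTransform hμb).mono fun t ht => hz₀'.trans_le ht.1
    obtain ⟨ρ, hρ, hρ'⟩ := intermediate_value_Icc' (le_max_left _ _) hcont ⟨h1, h0'.le⟩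
    exact ⟨ρ, hz₀'.trans_le hρ.1, hρ'⟩
  · rw [not_lt] at h
    -- The supremum gives only a weak inequality; passing through the midpoint of `b` and `z` makes
    -- it strict.
    have h1 := (hle ((b + z) / 2) (by linarith)).trans h
    have h2 : cauchyTransform μ ((b + z) / 2) ≤ 1 / θ := by exact_mod_cast h1
    exact (cauchyTransform_strictAntiOn hμb (show b < (b + z) / 2 by linarith) hz
      (by linarith)).trans_le h2

theorem isProbabilityMeasure_map_neg : IsProbabilityMeasure (μ.map Neg.neg) :=
  Measure.isProbabilityMeasure_map measurable_neg.aemeasurable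

theorem cauchyLeft_eq (hμa : ∀ᵐ t ∂μ, a ≤ t) :
    cauchyLeft μ a = - cauchyRight (μ.map Neg.neg) (-a) := by
  have := isProbabilityMeasure_map_neg (μ := μ)
  have h1 := ((tendsto_cauchyRight (ae_map_neg_le hμa)).1.comp (tendsto_neg_nhdsLT (a := a))).neg
  refine leftLim_eq_of_tendsto (h1.congr fun z => ?_)
  simp only [Function.comp]
  rw [cauchyTransform_map_neg, neg_neg, EReal.coe_neg, neg_neg]

theorem cauchyTransform_neg_of_lt (hμa : ∀ᵐ t ∂μ, a ≤ t) {z : ℝ} (hz : z < a) :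
    cauchyTransform μ z < 0 := by
  have := isProbabilityMeasure_map_neg (μ := μ)
  have := cauchyTransform_pos (ae_map_neg_le hμa) (neg_lt_neg hz)
  rw [cauchyTransform_map_neg, neg_neg] at this
  linarith

theorem convexHull_support_eq (hμ : IsCompact μ.support) (ha : a = sInf μ.support)
    (hb : b = sSup μ.support) :
    convexHull ℝ μ.support = Set.Icc a b ∧ a ∈ μ.support ∧ b ∈ μ.support := by
  have hne : μ.support.Nonempty := Measure.nonempty_support (IsProbabilityMeasure.ne_zero μ)
  have ha' : a ∈ μ.support := ha ▸ hμ.sInf_mem hne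
  have hb' : b ∈ μ.support := hb ▸ hμ.sSup_mem hne
  have hsub : μ.support ⊆ Set.Icc a b := fun t ht =>
    ⟨ha ▸ csInf_le hμ.bddBelow ht, hb ▸ le_csSup hμ.bddAbove ht⟩
  refine ⟨Set.Subset.antisymm (convexHull_min hsub (convex_Icc a b)) ?_, ha', hb'⟩
  rw [← segment_eq_Icc (hsub ha').2]
  exact segment_subset_convexHull ha' hb'

/-- The inverse is taken over both components of the complement of `[a, b]`; as `G < 0` on the left
one, the positive value `1 / θ` forces a preimage to the right of `b`. -/
theorem upper_limit_spec (hull : convexHull ℝ μ.support = Set.Icc a b) (hμa : ∀ᵐ t ∂μ, a ≤ t)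
    (hμb : ∀ᵐ t ∂μ, t ≤ b) {θ : ℝ} (hθ : 0 < θ) {ℓ : ℝ}
    [Decidable ((θ : EReal) > 1 / cauchyRight μ b)]
    (hℓ : ℓ = if (θ : EReal) > 1 / cauchyRight μ b then cauchyInverse μ (1 / θ) else b) :
    (b < ℓ ∧ cauchyTransform μ ℓ = 1 / θ) ∨
      (ℓ = b ∧ ∀ z, b < z → cauchyTransform μ z < 1 / θ) := by
  obtain ⟨h1, h2⟩ := exists_cauchyTransform_eq_or hμb hθ
  split_ifs at hℓ with h
  · obtain ⟨ρ, hρ, hρ'⟩ := h1 h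
    obtain ⟨h3, h4⟩ := cauchyInverse_spec hull (Or.inr hρ) hρ'
    rw [← hℓ] at h3 h4
    refine Or.inl ⟨h3.resolve_left fun h5 => ?_, h4⟩
    have h6 := cauchyTransform_neg_of_lt hμa h5
    have h7 := one_div_pos.mpr hθ
    linarith
  · exact Or.inr ⟨hℓ, h2 h⟩

theorem lower_limit_spec (hull : convexHull ℝ μ.support = Set.Icc a b) (hμa : ∀ᵐ t ∂μ, a ≤ t)
    (hμb : ∀ᵐ t ∂μ, t ≤ b) {θ : ℝ} (hθ : θ < 0) {ℓ : ℝ}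
    [Decidable ((θ : EReal) < 1 / cauchyLeft μ a)]
    (hℓ : ℓ = if (θ : EReal) < 1 / cauchyLeft μ a then cauchyInverse μ (1 / θ) else a) :
    (-a < -ℓ ∧ cauchyTransform (μ.map Neg.neg) (-ℓ) = 1 / (-θ)) ∨
      (-ℓ = -a ∧ ∀ z, -a < z → cauchyTransform (μ.map Neg.neg) z < 1 / (-θ)) := by
  have := isProbabilityMeasure_map_neg (μ := μ)
  obtain ⟨h1, h2⟩ := exists_cauchyTransform_eq_or (ae_map_neg_le hμa) (neg_pos.mpr hθ)
  have hiff : (θ : EReal) < 1 / cauchyLeft μ a ↔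
      ((-θ : ℝ) : EReal) > 1 / cauchyRight (μ.map Neg.neg) (-a) := by
    rw [cauchyLeft_eq hμa, gt_iff_lt, ← EReal.neg_lt_neg_iff, one_div, one_div, EReal.inv_neg,
      neg_neg, EReal.coe_neg]
  rw [← hiff] at h1 h2
  split_ifs at hℓ with h
  · obtain ⟨ρ, hρ, hρ'⟩ := h1 h
    rw [cauchyTransform_map_neg] at hρ'
    obtain ⟨h3, h4⟩ := cauchyInverse_spec hull (x := -ρ) (y := 1 / θ) (Or.inl (by linarith)) (by
      rw [div_neg] at hρ'
      linarith)
    rw [← hℓ] at h3 h4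
    refine Or.inl ⟨neg_lt_neg (h3.resolve_right fun h5 => ?_), ?_⟩
    · have h6 := cauchyTransform_pos hμb h5
      have h7 := one_div_neg.mpr hθ
      linarith
    · rw [cauchyTransform_map_neg, neg_neg, h4, div_neg]
  · exact Or.inr ⟨by rw [hℓ], h2 h⟩

end Edges

/-! ### Empirical measures and behaviour under negation. -/

section Empirical

variable {𝕜 : Type*} [RCLike 𝕜]

theorem integral_empiricalSpectralMeasure {n : ℕ} {A : Matrix (Fin n) (Fin n) 𝕜}
    (hA : A.IsHermitian) (f : BoundedContinuousFunction ℝ ℝ) :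
    ∫ t, f t ∂(empiricalSpectralMeasure hA : Measure ℝ) =
      (n : ℝ)⁻¹ * ∑ i : Fin n, f (lam hA (i + 1)) := by
  rw [empiricalSpectralMeasure, FiniteMeasure.toMeasure_smul, FiniteMeasure.toMeasure_sum,
    integral_smul_nnreal_measure, integral_finsetSum_measure fun k _ => f.integrable _,
    ← sum_lam hA f]
  have h : ∀ k, ∫ t, f t ∂((diracProba (lam hA k)).toFiniteMeasure : Measure ℝ) = f (lam hA k) :=
    fun k => integral_dirac f (lam hA k)
  simp_rw [h]
  rw [NNReal.smul_def]
  simp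

theorem sum_lam_neg {n : ℕ} {A : Matrix (Fin n) (Fin n) 𝕜} (hA : A.IsHermitian) (f : ℝ → ℝ) :
    ∑ i : Fin n, f (lam hA.neg (i + 1)) = ∑ i : Fin n, f (- lam hA (i + 1)) := by
  rw [← Equiv.sum_comp Fin.revPerm fun i : Fin n => f (- lam hA (i + 1))]
  refine Finset.sum_congr rfl fun i _ => ?_
  rw [lam_neg hA (by omega) i.2, Fin.revPerm_apply, Fin.val_rev]
  congr 3
  omega

theorem IsConjInvariant.neg {Ω : Type*} [MeasurableSpace Ω] {n : ℕ} {Pr : Measure Ω}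
    {M : Ω → Matrix (Fin n) (Fin n) 𝕜} (hM : Measurable M) (h : IsConjInvariant M Pr) :
    IsConjInvariant (fun ω => - M ω) Pr := by
  intro U hU
  have hneg : Measurable fun x : Matrix (Fin n) (Fin n) 𝕜 => -x := continuous_neg.measurable
  have h1 := congrArg (Measure.map fun x : Matrix (Fin n) (Fin n) 𝕜 => -x) (h U hU)
  have hm : Measurable fun ω => U * M ω * star U := (measurable_conj U).comp hM
  rw [Measure.map_map hneg hm, Measure.map_map hneg hM] at h1
  have h2 : (fun ω => U * -M ω * star U) = (fun x => -x) ∘ fun ω => U * M ω * star U := by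
    funext ω
    simp
  rw [h2]
  exact h1

end Empirical

end SpikedModel

/-! ### The theorem: both edges, the lower one by reflection. -/

theorem theorem2p1 {𝕜 : Type*} [RCLike 𝕜]
    {Ω : Type*} [MeasurableSpace Ω] (Pr : Measure Ω) [IsProbabilityMeasure Pr]
    -- the random matrices `X n` and `P n`, real symmetric (`𝕜 = ℝ`) or Hermitian (`𝕜 = ℂ`)
    (X P : (n : ℕ) → Ω → Matrix (Fin n) (Fin n) 𝕜)
    (hXm : ∀ n, Measurable (X n)) (hPm : ∀ n, Measurable (P n))
    (hX : ∀ n ω, (X n ω).IsHermitian) (hP : ∀ n ω, (P n ω).IsHermitian)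
    -- the limiting spectral measure and the edges of its support
    (μ : ProbabilityMeasure ℝ) (hμ : IsCompact (μ : Measure ℝ).support)
    (a b : ℝ) (ha : a = sInf (μ : Measure ℝ).support) (hb : b = sSup (μ : Measure ℝ).support)
    (hconv : ∀ᵐ ω ∂Pr, Tendsto (fun n => empiricalSpectralMeasure (hX n ω)) atTop
      (𝓝 μ.toFiniteMeasure))
    (hmin : ∀ᵐ ω ∂Pr, Tendsto (fun n => lam (hX n ω) n) atTop (𝓝 a))
    (hmax : ∀ᵐ ω ∂Pr, Tendsto (fun n => lam (hX n ω) 1) atTop (𝓝 b))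
    -- the non-zero eigenvalues `θ 1 ≥ ⋯ ≥ θ s > 0 > θ (s + 1) ≥ ⋯ ≥ θ r` of the perturbation
    (r : ℕ) (hr : 1 ≤ r) (s : ℕ) (hsr : s ≤ r) (θ : ℕ → ℝ)
    (hθ : AntitoneOn θ (Set.Icc 1 r))
    (hθpos : ∀ i ∈ Set.Icc 1 r, i ≤ s → 0 < θ i)
    (hθneg : ∀ i ∈ Set.Icc 1 r, s < i → θ i < 0)
    (hPeig : ∀ n, r ≤ n → ∀ᵐ ω ∂Pr,
      ((Finset.Icc 1 n).val.map (lam (hP n ω))).filter (fun x => x ≠ 0) =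
        (Finset.Icc 1 r).val.map θ)
    -- independence and invariance
    (hindep : ∀ n, r ≤ n → IndepFun (X n) (P n) Pr)
    (hinv : ∀ n, r ≤ n → IsConjInvariant (X n) Pr ∨ IsConjInvariant (P n) Pr) :
    -- the largest eigenvalues
    (∀ i, 1 ≤ i → i ≤ s → ∀ᵐ ω ∂Pr,
      Tendsto (fun n => lam ((hX n ω).add (hP n ω)) i) atTop
        (𝓝 (if (θ i : EReal) > 1 / cauchyRight μ b then cauchyInverse μ (1 / θ i) else b))) ∧
    (∀ i, s < i → ∀ᵐ ω ∂Pr,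
      Tendsto (fun n => lam ((hX n ω).add (hP n ω)) i) atTop (𝓝 b)) ∧
    -- the smallest eigenvalues
    (∀ j, j < r - s → ∀ᵐ ω ∂Pr,
      Tendsto (fun n => lam ((hX n ω).add (hP n ω)) (n - j)) atTop
        (𝓝 (if (θ (r - j) : EReal) < 1 / cauchyLeft μ a
          then cauchyInverse μ (1 / θ (r - j)) else a))) ∧
    (∀ j, r - s ≤ j → ∀ᵐ ω ∂Pr,
      Tendsto (fun n => lam ((hX n ω).add (hP n ω)) (n - j)) atTop (𝓝 a)) := by
  obtain ⟨hull, hamem, hbmem⟩ := convexHull_support_eq hμ ha hb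
  have hsupp : ∀ᵐ t ∂(μ : Measure ℝ), t ∈ (μ : Measure ℝ).support := Measure.support_mem_ae
  have hμa : ∀ᵐ t ∂(μ : Measure ℝ), a ≤ t := hsupp.mono fun t ht =>
    ha ▸ csInf_le hμ.bddBelow ht
  have hμb : ∀ᵐ t ∂(μ : Measure ℝ), t ≤ b := hsupp.mono fun t ht =>
    hb ▸ le_csSup hμ.bddAbove ht
  have hbpos : ∀ c < b, 0 < (μ : Measure ℝ) (Set.Ioi c) := fun c hc =>
    (Measure.mem_support_iff_forall b).mp hbmem _ (Ioi_mem_nhds hc)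
  have hapos : ∀ c < -a, 0 < ((μ : Measure ℝ).map Neg.neg) (Set.Ioi c) := fun c hc => by
    rw [Measure.map_apply measurable_neg measurableSet_Ioi]
    refine ((Measure.mem_support_iff_forall a).mp hamem _
      (Iio_mem_nhds (lt_neg_of_lt_neg hc))).trans_le (measure_mono fun t ht => ?_)
    have ht' : t < -c := ht
    exact lt_neg_of_lt_neg ht'
  have hprob := isProbabilityMeasure_map_neg (μ := (μ : Measure ℝ))
  have hcX : ∀ᵐ ω ∂Pr, ∀ f : BoundedContinuousFunction ℝ ℝ, Tendsto (fun n : ℕ => (n : ℝ)⁻¹ *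
      ∑ i : Fin n, f (lam (hX n ω) (i + 1))) atTop (𝓝 (∫ t, f t ∂(μ : Measure ℝ))) := by
    filter_upwards [hconv] with ω hω f
    have h := FiniteMeasure.tendsto_iff_forall_integral_tendsto.mp hω f
    simp_rw [integral_empiricalSpectralMeasure] at h
    exact h
  have hcX' : ∀ᵐ ω ∂Pr, ∀ f : BoundedContinuousFunction ℝ ℝ, Tendsto (fun n : ℕ => (n : ℝ)⁻¹ *
      ∑ i : Fin n, f (lam (hX n ω).neg (i + 1))) atTop
      (𝓝 (∫ t, f t ∂((μ : Measure ℝ).map Neg.neg))) := by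
    filter_upwards [hcX] with ω hω f
    have h := hω (f.compContinuous ⟨Neg.neg, continuous_neg⟩)
    rw [integral_map measurable_neg.aemeasurable f.continuous.aestronglyMeasurable]
    refine h.congr fun n => ?_
    rw [sum_lam_neg]
    rfl
  have hmax' : ∀ᵐ ω ∂Pr, Tendsto (fun n => lam (hX n ω).neg 1) atTop (𝓝 (-a)) := by
    filter_upwards [hmin] with ω hω
    refine hω.neg.congr' ?_
    filter_upwards [eventually_ge_atTop 1] with n hn
    rw [lam_neg _ le_rfl hn, Nat.add_sub_cancel]
  have hspikes : ∀ n, r ≤ n → ∀ᵐ ω ∂Pr, ∃ u, HasSpikes (P n ω) (fun j : Fin r => θ (j + 1)) u :=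
    fun n hn => (hPeig n hn).mono fun ω hω => hasSpikes_of_map_lam (hP n ω) hω
  have hspikes' : ∀ n, r ≤ n → ∀ᵐ ω ∂Pr, ∃ u,
      HasSpikes (-P n ω) (fun j : Fin r => -θ (j.rev + 1)) u := fun n hn =>
    (hspikes n hn).mono fun ω ⟨_, hu⟩ => ⟨_, hu.neg⟩
  have hmem : ∀ j : Fin r, (j : ℕ) + 1 ∈ Set.Icc 1 r := fun j => ⟨by omega, j.2⟩
  have hanti : Antitone fun j : Fin r => θ (j + 1) := fun i j hij =>
    hθ (hmem i) (hmem j) (Nat.succ_le_succ hij)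
  have hanti' : Antitone fun j : Fin r => -θ (j.rev + 1) := fun i j hij =>
    neg_le_neg (hanti (Fin.rev_le_rev.mpr hij))
  have hθ0 : ∀ j : Fin r, θ (j + 1) ≠ 0 := fun j => by
    rcases le_or_gt ((j : ℕ) + 1) s with h | h
    · exact (hθpos _ (hmem j) h).ne'
    · exact (hθneg _ (hmem j) h).ne
  have top := fun (k : ℕ) (hk : 1 ≤ k) (ℓ : ℝ) => ae_tendsto_lam_add hXm hPm hX hP hμb hbpos hcX
    hmax hanti hθ0 hspikes hindep hinv (k := k) hk (ℓ := ℓ)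
  have hnegm : ∀ n, Measurable fun x : Matrix (Fin n) (Fin n) 𝕜 => -x := fun n =>
    continuous_neg.measurable
  -- The upper-edge result for `-X`, `-P` and the reflected measure, whose upper edge is `-a`; the
  -- `(j + 1)`-st largest eigenvalue there is minus the eigenvalue of index `n - j` of `X + P`.
  have bot := fun (j : ℕ) (ℓ : ℝ) => ae_tendsto_lam_add (X := fun n ω => -X n ω)
    (P := fun n ω => -P n ω) (fun n => (hnegm n).comp (hXm n)) (fun n => (hnegm n).comp (hPm n))
    (fun n ω => (hX n ω).neg) (fun n ω => (hP n ω).neg) (ae_map_neg_le hμa) hapos hcX' hmax'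
    hanti' (fun j => neg_ne_zero.mpr (hθ0 j.rev)) hspikes'
    (fun n hn => (hindep n hn).comp (hnegm n) (hnegm n))
    (fun n hn => (hinv n hn).imp (IsConjInvariant.neg (hXm n)) (IsConjInvariant.neg (hPm n)))
    (k := j + 1) (Nat.le_add_left 1 j) (ℓ := -ℓ)
  have back : ∀ (j : ℕ) (ℓ : ℝ) ω, Tendsto (fun n => lam ((hX n ω).neg.add (hP n ω).neg) (j + 1))
      atTop (𝓝 (-ℓ)) → Tendsto (fun n => lam ((hX n ω).add (hP n ω)) (n - j)) atTop (𝓝 ℓ) := by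
    intro j ℓ ω h
    have h1 := h.neg
    rw [neg_neg] at h1
    refine h1.congr' ?_
    filter_upwards [eventually_ge_atTop (j + 1)] with n hn
    rw [lam_congr _ ((hX n ω).add (hP n ω)).neg (neg_add _ _).symm, lam_neg _ (by omega) hn,
      neg_neg, show n + 1 - (j + 1) = n - j by omega]
  refine ⟨fun i hi his => ?_, fun i hi => ?_, fun j hj => ?_, fun j hj => ?_⟩
  · have hpos := hθpos i ⟨hi, his.trans hsr⟩ his
    have hi' : i - 1 + 1 = i := Nat.sub_add_cancel hi
    refine top i hi _ ?_
    refine (upper_limit_spec hull hμa hμb hpos rfl).imp (fun h => ⟨h.1, ⟨i - 1, by omega⟩, hi', ?_⟩)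
      fun h => ⟨h.1, fun m hm _ => ?_⟩
    · simp only [hi']
      exact ⟨hpos, h.2⟩
    · rw [hm]
      exact h.2
  -- For `i > s` the index carries a negative spike or none at all, so the condition for sticking to
  -- the edge is vacuous.
  · refine top i (by omega) b (Or.inr ⟨rfl, fun m hm hm0 => ?_⟩)
    exact absurd hm0 (hθneg _ (hmem m) (by omega)).not_gt
  · have hneg := hθneg (r - j) ⟨by omega, by omega⟩ (by omega)
    have hrev : ∀ m : Fin r, (m : ℕ) = j → (m.rev : ℕ) + 1 = r - j := fun m hm => by
      rw [Fin.val_rev]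
      omega
    refine (bot j _ ?_).mono fun ω hω => back j _ ω hω
    refine (lower_limit_spec hull hμa hμb hneg rfl).imp
      (fun h => ⟨h.1, ⟨j, by omega⟩, rfl, ?_⟩) fun h => ⟨h.1, fun m hm _ => ?_⟩
    · rw [hrev ⟨j, by omega⟩ rfl]
      exact ⟨neg_pos.mpr hneg, h.2⟩
    · rw [hrev m (by omega)]
      exact h.2
  · refine (bot j a (Or.inr ⟨rfl, fun m hm hm0 => ?_⟩)).mono fun ω hω => back j _ ω hω
    have h1 := hθpos _ (hmem m.rev) (by rw [Fin.val_rev]; omega)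
    exact absurd (neg_pos.mp hm0) h1.not_gt
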